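/- Let $n\ge 1$ be an integer, $X$ a nonempty set, $R$ a commutative ring, and let $\beta,\ \alpha_{ab},\ \delta_{ab},\ \gamma_{ab}\in R$ ($a,b\in X$) be arbitrary parameters (for instance indeterminates over $\mathbb C$). **Diagrams.** A *diagram* is a rectangle with nodes $1,\dots,n$ (from top to bottom) on each of its left and right sides and with a top and a bottom boundary, in which non-crossing strings are drawn such that every node is the end of exactly one string, every string connects a node to another node or to a boundary, and every string end on a boundary carries a label from $X$. Two diagrams are equal if their strings connect the same nodes to each other or to the same boundary and corresponding boundary ends have the same labels. A diagram is *even* (*odd*) if the number of strings connected to the top boundary and the number connected to the bottom boundary are both even (both odd). **The label algebra.** $\mathrm{L}_n(X)$ is the free $R$-module on the set of diagrams, with the bilinear product given on diagrams $D,E$ by placing $E$ to the right of $D$, identifying the right nodes of $D$ with the left nodes of $E$, replacing each loop by the factor $\beta$, and replacing each *boundary arc* (a string with both ends on the boundaries) by the factor $\alpha_{ab}$ if both ends are on the top boundary, with left label $a$ and right label $b$; by $\delta_{ab}$ if both ends are on the bottom boundary, with left label $a$ and right label $b$; and by $\gamma_{ab}$ if it connects the top boundary, with label $a$, to the bottom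 boundary, with label $b$. **Generators.** Let $a,b\in X$. In the following diagrams, all strings that are not mentioned connect node $k$ on the left to node $k$ on the right. The identity $\mathbb 1$ consists of such strings only. For $1\le i\le n-1$, $e_i$ links nodes $i$ and $i+1$ on the left, and also on the right. $f^{\rm top}_{ab}$ connects node $1$ on the left and node $1$ on the right to the top boundary, with labels $a$ and $b$ respectively. $f^{\rm bot}_{ab}$ connects node $n$ on the left and node $n$ on the right to the bottom boundary, with labels $a$ and $b$ respectively. Finally, $w^{\rm top}_{ab}$ connects node $1$ on the left to the top boundary with label $a$, node $n$ on the right to the bottom boundary with label $b$, and node $k+1$ on the left to node $k$ on the right for $1\le k\le n-1$; and $w^{\rm bot}_{ab}$ connects node $1$ on the right to the top boundary with label $a$, node $n$ on the left to the bottom boundary with label $b$, and node $k$ on the left to node $k+1$ on the right for $1\le k\le n-1$. Let $W_{ab}(0)=w^{\rm top}_{ab}$, $W_{ab}(n)=w^{\rm bot}_{ab}$, and let $W_{ab}(j)=e_je_{j-1}\cdots e_1w^{\rm top}_{ab}$ for $1\le j\le n-1$ (a single diagram). **Theorem.** 1. The algebra $\mathrm{L}_n(X)$ is generated by $\mathbb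 1$, $e_i$ ($1\le i\le n-1$), $f^{\rm top}_{ab}$, $f^{\rm bot}_{ab}$, $w^{\rm top}_{ab}$ and $w^{\rm bot}_{ab}$ ($a,b\in X$). 2. Every even diagram is a (possibly empty) product of diagrams $e_i$, $f^{\rm top}_{ab}$ and $f^{\rm bot}_{ab}$ such that the concatenation produces no loops and no boundary arcs. 3. For every odd diagram $D$ there are $a,b\in X$, $0\le j\le n$ and an even diagram $T$ such that concatenating $W_{ab}(j)$ and $T$ gives $D$ and produces no loops and no boundary arcs. Moreover, for given $D$ and $W_{ab}(j)$ there is at most one diagram $T$ such that concatenating $W_{ab}(j)$ and $T$ gives $D$ and produces no loops and no boundary arcs. -/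

import Mathlib

namespace LabelAlg

/-! ### Label diagrams

A diagram lives in a rectangle with `n` nodes on its left side and `n` nodes on its right side,
numbered from top to bottom, and with a top and a bottom boundary line. -/

/-- The nodes of a diagram: `Sum.inl i` is the `i`-th node on the left side and `Sum.inr i` is the
`i`-th node on the right side, counted from the top (starting from `0`). -/
abbrev Node (n : ℕ) := Fin n ⊕ Fin n

/-- The two boundaries of the rectangle. -/
inductive Bdry where
  | top : Bdry
  | bot : Bdry

/-- Position of a node on the perimeter of the rectangle, going clockwise from the top boundary:
the top boundary is at `0`, the right side, from top to bottom, at `1, …, n`, the bottom boundary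
at `n + 1` and the left side, from bottom to top, at `n + 2, …, 2 n + 1`. -/
def nodePos {n : ℕ} : Node n → ℕ
  | Sum.inl i => 2 * n + 1 - i
  | Sum.inr i => i + 1

/-- Position on the perimeter of an end of a string: a node, or a labelled point on a boundary. -/
def endPos {n : ℕ} {X : Type*} : Node n ⊕ (Bdry × X) → ℕ
  | Sum.inl v => nodePos v
  | Sum.inr (Bdry.top, _) => 0
  | Sum.inr (Bdry.bot, _) => n + 1

/-- The chord with ends at `x, y` and the chord with ends at `z, w` interleave strictly.  Chords
sharing an end do not count as crossing: several strings may end on the same boundary, and their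
ends there can always be ordered so that these strings do not meet. -/
def Crosses (x y z w : ℕ) : Prop :=
  min x y < min z w ∧ min z w < max x y ∧ max x y < max z w

/-- A label diagram, up to the equality of diagrams: every node `v` has exactly one string end
attached to it; `conn v` is the other end of that string, which is another node or a boundary,
and in the latter case the end on the boundary carries a label from `X`.  The strings can be drawn
without crossings. -/
@[ext]
structure Diagram (n : ℕ) (X : Type*) where
  conn : Node n → Node n ⊕ (Bdry × X)
  conn_ne : ∀ v, conn v ≠ Sum.inl v
  conn_symm : ∀ v w, conn v = Sum.inl w → conn w = Sum.inl v
  planar : ∀ v w, ¬ Crosses (nodePos v) (endPos (conn v)) (nodePos w) (endPos (conn w))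

section Concatenation

variable {n : ℕ} {X : Type*}

/-- The nodes of the concatenation of two diagrams, before the right nodes of the first diagram
are identified with the left nodes of the second one: `Sum.inl v` is the node `v` of the first
diagram, `Sum.inr v` is the node `v` of the second diagram. -/
abbrev CNode (n : ℕ) := Node n ⊕ Node n

/-- The other end of the string, inside the first or the second diagram, attached at a node. -/
def piece (D E : Diagram n X) : CNode n → CNode n ⊕ (Bdry × X)
  | Sum.inl v => Sum.map Sum.inl id (D.conn v)
  | Sum.inr v => Sum.map Sum.inr id (E.conn v)

/-- Two nodes of the concatenation are adjacent if they are the ends of a string of one of the two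
diagrams, or if they are a right node of the first diagram and the corresponding left node of the
second one. -/
def Adjacent (D E : Diagram n X) (p q : CNode n) : Prop :=
  piece D E p = Sum.inl q ∨ ∃ m : Fin n, p = Sum.inl (Sum.inr m) ∧ q = Sum.inr (Sum.inl m)

/-- Two nodes lie on the same string of the concatenation. -/
def Joined (D E : Diagram n X) : CNode n → CNode n → Prop :=
  Relation.EqvGen (Adjacent D E)

/-- The left nodes of the first diagram and the right nodes of the second diagram are the nodes of
the concatenation. -/
def outer : Node n → CNode n
  | Sum.inl i => Sum.inl (Sum.inl i)
  | Sum.inr i => Sum.inr (Sum.inr i)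

/-- `e` is the other end of the string of the concatenation that starts at the outer node `u`. -/
def HasEnd (D E : Diagram n X) (u : Node n) : Node n ⊕ (Bdry × X) → Prop
  | Sum.inl w => w ≠ u ∧ Joined D E (outer u) (outer w)
  | Sum.inr b => ∃ p, Joined D E (outer u) p ∧ piece D E p = Sum.inr b

/-! #### Concatenation is well defined

The nodes in the middle are glued one after the other, from the top to the bottom. -/

/-- Adjacency when only the first `k` nodes in the middle have been glued. -/
def AdjacentUpTo (D E : Diagram n X) (k : ℕ) (p q : CNode n) : Prop :=
  piece D E p = Sum.inl q ∨
    ∃ m : Fin n, (m : ℕ) < k ∧ p = Sum.inl (Sum.inr m) ∧ q = Sum.inr (Sum.inl m)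

/-- The nodes that have not been glued after `k` steps. -/
def Free (k : ℕ) : CNode n → Prop
  | Sum.inl (Sum.inl _) => True
  | Sum.inl (Sum.inr m) => k ≤ (m : ℕ)
  | Sum.inr (Sum.inl m) => k ≤ (m : ℕ)
  | Sum.inr (Sum.inr _) => True

/-- Position of a node along the perimeter during the gluing. -/
def cPos : CNode n → ℕ
  | Sum.inr (Sum.inr i) => i + 1
  | Sum.inr (Sum.inl i) => 2 * n + 1 - i
  | Sum.inl (Sum.inr i) => 2 * n + 2 + i
  | Sum.inl (Sum.inl i) => 4 * n + 2 - i

/-- Position of the boundary end of the string attached at a node during the gluing. -/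
def bPos (D E : Diagram n X) (p : CNode n) : ℕ :=
  match p, piece D E p with
  | _, Sum.inr (Bdry.top, _) => 0
  | Sum.inr _, Sum.inr (Bdry.bot, _) => n + 1
  | Sum.inl _, Sum.inr (Bdry.bot, _) => 3 * n + 2
  | _, _ => 0

/-- Position of an end, given as a node, or as the boundary end attached at a node. -/
def ePos (D E : Diagram n X) : CNode n ⊕ CNode n → ℕ
  | Sum.inl p => cPos p
  | Sum.inr p => bPos D E p

theorem eqvGen_add_edge {α : Type*} {r s : α → α → Prop} {a b : α}
    (h : ∀ x y, s x y → r x y ∨ (x = a ∧ y = b)) {x y : α} (hxy : Relation.EqvGen s x y) :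
    Relation.EqvGen r x y ∨ (Relation.EqvGen r x a ∧ Relation.EqvGen r b y) ∨
      (Relation.EqvGen r x b ∧ Relation.EqvGen r a y) := by
  induction hxy with
  | rel x y hs =>
    rcases h x y hs with h1 | ⟨rfl, rfl⟩
    · exact Or.inl (.rel _ _ h1)
    · exact Or.inr (Or.inl ⟨.refl _, .refl _⟩)
  | refl x => exact Or.inl (.refl _)
  | symm x y _ ih =>
    rcases ih with h1 | ⟨h1, h2⟩ | ⟨h1, h2⟩
    · exact Or.inl h1.symm
    · exact Or.inr (Or.inr ⟨h2.symm, h1.symm⟩)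
    · exact Or.inr (Or.inl ⟨h2.symm, h1.symm⟩)
  | trans x y z _ _ ih1 ih2 =>
    rcases ih1 with h1 | ⟨h1, h2⟩ | ⟨h1, h2⟩ <;> rcases ih2 with h3 | ⟨h3, h4⟩ | ⟨h3, h4⟩
    · exact Or.inl (h1.trans _ _ _ h3)
    · exact Or.inr (Or.inl ⟨h1.trans _ _ _ h3, h4⟩)
    · exact Or.inr (Or.inr ⟨h1.trans _ _ _ h3, h4⟩)
    · exact Or.inr (Or.inl ⟨h1, h2.trans _ _ _ h3⟩)
    · exact Or.inr (Or.inl ⟨h1, h4⟩)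
    · exact Or.inl (h1.trans _ _ _ h4)
    · exact Or.inr (Or.inr ⟨h1, h2.trans _ _ _ h3⟩)
    · exact Or.inl (h1.trans _ _ _ h4)
    · exact Or.inr (Or.inr ⟨h1, h4⟩)

/-- `c` describes the strings after `k` gluing steps. -/
structure Partial (D E : Diagram n X) (k : ℕ) (c : CNode n → CNode n ⊕ CNode n) : Prop where
  free : ∀ u w, Free k u → c u = Sum.inl w →
    Free k w ∧ w ≠ u ∧ c w = Sum.inl u ∧ Relation.EqvGen (AdjacentUpTo D E k) u w
  bdry : ∀ u p, Free k u → c u = Sum.inr p →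
    Relation.EqvGen (AdjacentUpTo D E k) u p ∧ ∃ b, piece D E p = Sum.inr b
  uniq : ∀ u w, Free k u → Free k w → Relation.EqvGen (AdjacentUpTo D E k) u w →
    w = u ∨ c u = Sum.inl w
  uniq' : ∀ u p b, Free k u → Relation.EqvGen (AdjacentUpTo D E k) u p →
    piece D E p = Sum.inr b → c u = Sum.inr p
  planar : ∀ u w, Free k u → Free k w →
    ¬ Crosses (cPos u) (ePos D E (c u)) (cPos w) (ePos D E (c w))

theorem piece_symm (D E : Diagram n X) (p q : CNode n) (h : piece D E p = Sum.inl q) :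
    q ≠ p ∧ piece D E q = Sum.inl p := by
  rcases p with v | v
  · rcases hv : D.conn v with w | b
    · simp only [piece, hv, Sum.map_inl, Sum.inl.injEq] at h
      subst h
      refine ⟨fun h => D.conn_ne v ?_, by simp [piece, D.conn_symm v w hv]⟩
      rw [hv]; simpa using h
    · simp [piece, hv] at h
  · rcases hv : E.conn v with w | b
    · simp only [piece, hv, Sum.map_inl, Sum.inl.injEq] at h
      subst h
      refine ⟨fun h => E.conn_ne v ?_, by simp [piece, E.conn_symm v w hv]⟩
      rw [hv]; simpa using h
    · simp [piece, hv] at h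

theorem eqvGen_zero (D E : Diagram n X) {p q : CNode n}
    (h : Relation.EqvGen (AdjacentUpTo D E 0) p q) : q = p ∨ piece D E p = Sum.inl q := by
  induction h with
  | rel x y h =>
    rcases h with h | ⟨m, hm, -⟩
    · exact Or.inr h
    · omega
  | refl x => exact Or.inl rfl
  | symm x y _ ih =>
    rcases ih with rfl | h
    · exact Or.inl rfl
    · exact Or.inr (piece_symm D E _ _ h).2
  | trans x y z _ _ ih1 ih2 =>
    rcases ih1 with rfl | h1
    · exact ih2
    · rcases ih2 with rfl | h2
      · exact Or.inr h1
      · have := (piece_symm D E _ _ h1).2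
        rw [h2] at this
        exact Or.inl (by simpa using this)

/-- The strings before any gluing. -/
def conn₀ (D E : Diagram n X) (p : CNode n) : CNode n ⊕ CNode n :=
  Sum.map id (fun _ => p) (piece D E p)

theorem nodePos_pos (v : Node n) : 0 < nodePos v := by
  rcases v with i | i <;> simp only [nodePos] <;> omega

theorem nodePos_le (v : Node n) : nodePos v ≤ 2 * n + 1 := by
  rcases v with i | i <;> simp only [nodePos] <;> omega

theorem endPos_le (e : Node n ⊕ (Bdry × X)) : endPos e ≤ 2 * n + 1 := by
  rcases e with v | ⟨_ | _, b⟩ <;> simp only [endPos]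
  · exact nodePos_le v
  all_goals omega

theorem cPos_inl (v : Node n) : cPos (Sum.inl v) = nodePos v + (2 * n + 1) := by
  rcases v with i | i <;> simp only [nodePos, cPos] <;> omega

theorem cPos_inr (v : Node n) : cPos (Sum.inr v) = nodePos v := by
  rcases v with i | i <;> simp only [nodePos, cPos]

theorem ePos_conn₀_inl (D E : Diagram n X) (v : Node n) :
    ePos D E (conn₀ D E (Sum.inl v)) =
      if endPos (D.conn v) = 0 then 0 else endPos (D.conn v) + (2 * n + 1) := by
  rcases hv : D.conn v with w | ⟨_ | _, b⟩
  · have := nodePos_pos w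
    have h : nodePos w ≠ 0 := by omega
    simp [conn₀, piece, hv, ePos, endPos, cPos_inl, h]
  · simp [conn₀, piece, hv, ePos, bPos, endPos]
  · simp [conn₀, piece, hv, ePos, bPos, endPos]
    omega

theorem ePos_conn₀_inr (D E : Diagram n X) (v : Node n) :
    ePos D E (conn₀ D E (Sum.inr v)) = endPos (E.conn v) := by
  rcases hv : E.conn v with w | ⟨_ | _, b⟩ <;> simp [conn₀, piece, hv, ePos, bPos, endPos, cPos_inr]

theorem partial_zero (D E : Diagram n X) : Partial D E 0 (conn₀ D E) where
  free u w _ h := by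
    rcases hp : piece D E u with q | b
    · simp only [conn₀, hp, Sum.map_inl, id, Sum.inl.injEq] at h
      subst h
      have := piece_symm D E _ _ hp
      refine ⟨?_, this.1, by simp [conn₀, this.2], .rel _ _ (Or.inl hp)⟩
      rcases q with (_ | _) | (_ | _) <;> simp [Free]
    · simp [conn₀, hp] at h
  bdry u p _ h := by
    rcases hp : piece D E u with q | b
    · simp [conn₀, hp] at h
    · simp only [conn₀, hp, Sum.map_inr, Sum.inr.injEq] at h
      subst h
      exact ⟨.refl _, b, hp⟩
  uniq u w _ _ h := by
    rcases eqvGen_zero D E h with h | h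
    · exact Or.inl h
    · exact Or.inr (by simp [conn₀, h])
  uniq' u p b _ h hb := by
    rcases eqvGen_zero D E h with rfl | h
    · simp [conn₀, hb]
    · have := (piece_symm D E _ _ h).2
      rw [hb] at this
      simp at this
  planar u w _ _ := by
    rcases u with u | u <;> rcases w with w | w
    · have h := D.planar u w
      rw [cPos_inl, cPos_inl, ePos_conn₀_inl, ePos_conn₀_inl]
      have h1 := nodePos_pos u
      have h2 := nodePos_pos w
      unfold Crosses at *
      split_ifs <;> omega
    · rw [cPos_inl, cPos_inr, ePos_conn₀_inl, ePos_conn₀_inr]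
      have h1 := nodePos_le w
      have h2 := endPos_le (E.conn w)
      unfold Crosses
      split_ifs <;> omega
    · rw [cPos_inl, cPos_inr, ePos_conn₀_inl, ePos_conn₀_inr]
      have h1 := nodePos_le u
      have h2 := endPos_le (E.conn u)
      unfold Crosses
      split_ifs <;> omega
    · have h := E.planar u w
      rwa [cPos_inr, cPos_inr, ePos_conn₀_inr, ePos_conn₀_inr]

theorem crosses_glue {a a' u e x y : ℕ} (haa : a' < a)
    (hu : u < a' ∨ a < u) (he : e < a' ∨ a < e) (hx : x < a' ∨ a < x) (hy : y < a' ∨ a < y)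
    (h1 : ¬ Crosses u a x y) (h2 : ¬ Crosses x y u a)
    (h3 : ¬ Crosses a' e x y) (h4 : ¬ Crosses x y a' e) :
    ¬ Crosses u e x y ∧ ¬ Crosses x y u e := by
  unfold Crosses at *
  rcases le_total x y with hxy | hxy <;> rcases le_total u e with hue | hue <;>
  rcases hu with hu | hu <;> rcases he with he | he <;> constructor <;> omega

theorem crosses_comm (x y z w : ℕ) : Crosses x y z w ↔ Crosses y x z w := by
  unfold Crosses; rw [min_comm, max_comm]

theorem crosses_comm' (x y z w : ℕ) : Crosses x y z w ↔ Crosses x y w z := by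
  unfold Crosses; rw [min_comm z, max_comm z]

theorem not_crosses_self (x y : ℕ) : ¬ Crosses x y x y := by
  unfold Crosses; omega

theorem free_succ_iff {k : ℕ} (hk : k < n) (u : CNode n) :
    Free (k + 1) u ↔ Free k u ∧ u ≠ Sum.inl (Sum.inr ⟨k, hk⟩) ∧ u ≠ Sum.inr (Sum.inl ⟨k, hk⟩) := by
  rcases u with (i | i) | (i | i) <;> simp [Free, Fin.ext_iff] <;> omega

theorem cPos_of_free {k : ℕ} (hk : k < n) {u : CNode n} (h : Free (k + 1) u) :
    cPos u < 2 * n + 1 - k ∨ 2 * n + 2 + k < cPos u := by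
  rcases u with (i | i) | (i | i) <;> simp [Free, cPos] at * <;> omega

theorem bPos_range (D E : Diagram n X) {k : ℕ} (hk : k < n) (u : CNode n) :
    bPos D E u < 2 * n + 1 - k ∨ 2 * n + 2 + k < bPos D E u := by
  unfold bPos
  split <;> omega

theorem partial_succ (D E : Diagram n X) (k : ℕ) (hk : k < n)
    (c : CNode n → CNode n ⊕ CNode n) (hc : Partial D E k c) :
    ∃ c', Partial D E (k + 1) c' := by
  classical
  obtain ⟨p, hp⟩ : ∃ p : CNode n, p = Sum.inl (Sum.inr ⟨k, hk⟩) := ⟨_, rfl⟩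
  obtain ⟨q, hq⟩ : ∃ q : CNode n, q = Sum.inr (Sum.inl ⟨k, hk⟩) := ⟨_, rfl⟩
  have hpq : p ≠ q := by rw [hp, hq]; simp
  have hfp : Free k p := by rw [hp]; simp [Free]
  have hfq : Free k q := by rw [hq]; simp [Free]
  have hF : ∀ u, Free (k + 1) u ↔ Free k u ∧ u ≠ p ∧ u ≠ q := by
    rw [hp, hq]; exact free_succ_iff hk
  have hPp : cPos p = 2 * n + 2 + k := by rw [hp]; rfl
  have hPq : cPos q = 2 * n + 1 - k := by rw [hq]; rfl
  have hmono : ∀ {u v}, Relation.EqvGen (AdjacentUpTo D E k) u v →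
      Relation.EqvGen (AdjacentUpTo D E (k + 1)) u v := fun h =>
    h.mono (by
      rintro a b (h | ⟨m, hm, h⟩)
      · exact Or.inl h
      · exact Or.inr ⟨m, by omega, h⟩)
  have hedge : Relation.EqvGen (AdjacentUpTo D E (k + 1)) p q :=
    .rel _ _ (Or.inr ⟨⟨k, hk⟩, by simp, hp, hq⟩)
  have hadd : ∀ {u v}, Relation.EqvGen (AdjacentUpTo D E (k + 1)) u v →
      Relation.EqvGen (AdjacentUpTo D E k) u v ∨
      (Relation.EqvGen (AdjacentUpTo D E k) u p ∧ Relation.EqvGen (AdjacentUpTo D E k) q v) ∨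
      (Relation.EqvGen (AdjacentUpTo D E k) u q ∧ Relation.EqvGen (AdjacentUpTo D E k) p v) := by
    intro u v h
    refine eqvGen_add_edge ?_ h
    rintro a b (h | ⟨m, hm, h1, h2⟩)
    · exact Or.inl (Or.inl h)
    · rcases Nat.lt_succ_iff_lt_or_eq.1 hm with hm | hm
      · exact Or.inl (Or.inr ⟨m, hm, h1, h2⟩)
      · have : m = ⟨k, hk⟩ := Fin.ext hm
        subst this
        exact Or.inr ⟨h1.trans hp.symm, h2.trans hq.symm⟩
  let c' : CNode n → CNode n ⊕ CNode n := fun u =>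
    if c u = Sum.inl p then c q else if c u = Sum.inl q then c p else c u
  have c1 : ∀ u, c u = Sum.inl p → c' u = c q := fun u h => by simp [c', h]
  have c2 : ∀ u, c u = Sum.inl q → c' u = c p := fun u h => by simp [c', h, hpq.symm]
  have c3 : ∀ u, c u ≠ Sum.inl p → c u ≠ Sum.inl q → c' u = c u := fun u h h' => by
    simp [c', h, h']
  have hinv : ∀ {u w}, Free k u → c u = Sum.inl w → c w = Sum.inl u := fun hu h =>
    (hc.free _ _ hu h).2.2.1
  have hconn : ∀ {u w}, Free k u → c u = Sum.inl w →
      Relation.EqvGen (AdjacentUpTo D E (k + 1)) u w := fun hu h =>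
    hmono (hc.free _ _ hu h).2.2.2
  -- the ends of a string through the glued nodes
  have hnew : ∀ {u}, Free (k + 1) u → (c u = Sum.inl p → c q ≠ Sum.inl p ∧ c q ≠ Sum.inl q) ∧
      (c u = Sum.inl q → c p ≠ Sum.inl p ∧ c p ≠ Sum.inl q) := by
    intro u hu
    obtain ⟨hu0, hup, huq⟩ := (hF u).1 hu
    refine ⟨fun h => ⟨fun h' => ?_, fun h' => (hc.free _ _ hfq h').2.1 rfl⟩,
      fun h => ⟨fun h' => (hc.free _ _ hfp h').2.1 rfl, fun h' => ?_⟩⟩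
    · have h1 := hinv hfq h'
      have h2 := hinv hu0 h
      rw [h1] at h2
      exact huq (by simpa using h2.symm)
    · have h1 := hinv hfp h'
      have h2 := hinv hu0 h
      rw [h1] at h2
      exact hup (by simpa using h2.symm)
  refine ⟨c', ?_, ?_, ?_, ?_, ?_⟩
  · intro u w hu h
    obtain ⟨hu0, hup, huq⟩ := (hF u).1 hu
    by_cases h1 : c u = Sum.inl p
    · rw [c1 u h1] at h
      obtain ⟨hw, -, hcw, hqw⟩ := hc.free _ _ hfq h
      have hwp : w ≠ p := fun e => ((hnew hu).1 h1).1 (e ▸ h)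
      have hwq : w ≠ q := fun e => ((hnew hu).1 h1).2 (e ▸ h)
      refine ⟨(hF w).2 ⟨hw, hwp, hwq⟩, ?_, ?_, ?_⟩
      · rintro rfl
        rw [h1] at hcw
        exact hpq (by simpa using hcw)
      · rw [c2 w hcw]
        exact hinv hu0 h1
      · exact ((hconn hu0 h1).trans _ _ _ hedge).trans _ _ _ (hmono hqw)
    · by_cases h2 : c u = Sum.inl q
      · rw [c2 u h2] at h
        obtain ⟨hw, -, hcw, hpw⟩ := hc.free _ _ hfp h
        have hwp : w ≠ p := fun e => ((hnew hu).2 h2).1 (e ▸ h)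
        have hwq : w ≠ q := fun e => ((hnew hu).2 h2).2 (e ▸ h)
        refine ⟨(hF w).2 ⟨hw, hwp, hwq⟩, ?_, ?_, ?_⟩
        · rintro rfl
          exact h1 hcw
        · rw [c1 w hcw]
          exact hinv hu0 h2
        · exact ((hconn hu0 h2).trans _ _ _ hedge.symm).trans _ _ _ (hmono hpw)
      · rw [c3 u h1 h2] at h
        obtain ⟨hw, hwu, hcw, huw⟩ := hc.free _ _ hu0 h
        have hwp : w ≠ p := fun e => h1 (e ▸ h)
        have hwq : w ≠ q := fun e => h2 (e ▸ h)
        refine ⟨(hF w).2 ⟨hw, hwp, hwq⟩, hwu, ?_, hmono huw⟩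
        rw [c3 w (by rw [hcw]; simpa using hup) (by rw [hcw]; simpa using huq)]
        exact hcw
  · intro u r hu h
    obtain ⟨hu0, hup, huq⟩ := (hF u).1 hu
    by_cases h1 : c u = Sum.inl p
    · rw [c1 u h1] at h
      obtain ⟨h3, h4⟩ := hc.bdry _ _ hfq h
      exact ⟨((hconn hu0 h1).trans _ _ _ hedge).trans _ _ _ (hmono h3), h4⟩
    · by_cases h2 : c u = Sum.inl q
      · rw [c2 u h2] at h
        obtain ⟨h3, h4⟩ := hc.bdry _ _ hfp h
        exact ⟨((hconn hu0 h2).trans _ _ _ hedge.symm).trans _ _ _ (hmono h3), h4⟩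
      · rw [c3 u h1 h2] at h
        obtain ⟨h3, h4⟩ := hc.bdry _ _ hu0 h
        exact ⟨hmono h3, h4⟩
  · intro u w hu hw h
    obtain ⟨hu0, hup, huq⟩ := (hF u).1 hu
    obtain ⟨hw0, hwp, hwq⟩ := (hF w).1 hw
    rcases hadd h with h | ⟨h1, h2⟩ | ⟨h1, h2⟩
    · rcases hc.uniq u w hu0 hw0 h with h | h
      · exact Or.inl h
      · refine Or.inr ?_
        rw [c3 u (by rw [h]; simpa using hwp) (by rw [h]; simpa using hwq)]
        exact h
    · have h3 := (hc.uniq u p hu0 hfp h1).resolve_left hup.symm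
      have h4 := (hc.uniq q w hfq hw0 h2).resolve_left hwq
      exact Or.inr ((c1 u h3).trans h4)
    · have h3 := (hc.uniq u q hu0 hfq h1).resolve_left huq.symm
      have h4 := (hc.uniq p w hfp hw0 h2).resolve_left hwp
      exact Or.inr ((c2 u h3).trans h4)
  · intro u r b hu h hb
    obtain ⟨hu0, hup, huq⟩ := (hF u).1 hu
    rcases hadd h with h | ⟨h1, h2⟩ | ⟨h1, h2⟩
    · have := hc.uniq' u r b hu0 h hb
      rw [c3 u (by simp [this]) (by simp [this])]
      exact this
    · have h3 := (hc.uniq u p hu0 hfp h1).resolve_left hup.symm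
      exact (c1 u h3).trans (hc.uniq' q r b hfq h2 hb)
    · have h3 := (hc.uniq u q hu0 hfq h1).resolve_left huq.symm
      exact (c2 u h3).trans (hc.uniq' p r b hfp h2 hb)
  · have haa : cPos q < cPos p := by omega
    have hout : ∀ {u}, Free (k + 1) u → cPos u < cPos q ∨ cPos p < cPos u := fun hu => by
      rw [hPp, hPq]; exact cPos_of_free hk hu
    have heout : ∀ {u}, Free k u → c u ≠ Sum.inl p → c u ≠ Sum.inl q →
        ePos D E (c u) < cPos q ∨ cPos p < ePos D E (c u) := by
      intro u hu h1 h2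
      rcases h : c u with w | r
      · refine hout ((hF w).2 ⟨(hc.free _ _ hu h).1, ?_, ?_⟩)
        · rintro rfl; exact h1 h
        · rintro rfl; exact h2 h
      · rw [hPp, hPq]; exact bPos_range D E hk r
    -- a string through the glued nodes does not cross an old string
    have hold : ∀ {u w}, Free (k + 1) u → Free (k + 1) w →
        (c u = Sum.inl p ∨ c u = Sum.inl q) → c w ≠ Sum.inl p → c w ≠ Sum.inl q →
        ¬ Crosses (cPos u) (ePos D E (c' u)) (cPos w) (ePos D E (c' w)) ∧
        ¬ Crosses (cPos w) (ePos D E (c' w)) (cPos u) (ePos D E (c' u)) := by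
      intro u w hu hw huu hw1 hw2
      obtain ⟨hu0, hup, huq⟩ := (hF u).1 hu
      obtain ⟨hw0, hwp, hwq⟩ := (hF w).1 hw
      rw [c3 w hw1 hw2]
      rcases huu with h1 | h1
      · rw [c1 u h1]
        have hn := (hnew hu).1 h1
        have e1 := hc.planar u w hu0 hw0
        have e2 := hc.planar w u hw0 hu0
        rw [h1] at e1 e2
        exact crosses_glue haa (hout hu) (heout hfq hn.1 hn.2) (hout hw) (heout hw0 hw1 hw2)
          e1 e2 (hc.planar q w hfq hw0) (hc.planar w q hw0 hfq)
      · rw [c2 u h1]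
        have hn := (hnew hu).2 h1
        have e1 := hc.planar u w hu0 hw0
        have e2 := hc.planar w u hw0 hu0
        rw [h1, crosses_comm] at e1
        rw [h1, crosses_comm'] at e2
        have e3 := hc.planar p w hfp hw0
        have e4 := hc.planar w p hw0 hfp
        rw [crosses_comm] at e3
        rw [crosses_comm'] at e4
        have := crosses_glue haa (heout hfp hn.1 hn.2) (hout hu) (hout hw) (heout hw0 hw1 hw2)
          e3 e4 e1 e2
        rwa [crosses_comm, crosses_comm' _ _ (ePos D E (c p))] at this
    intro u w hu hw
    obtain ⟨hu0, hup, huq⟩ := (hF u).1 hu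
    obtain ⟨hw0, hwp, hwq⟩ := (hF w).1 hw
    by_cases hu1 : c u = Sum.inl p ∨ c u = Sum.inl q
    · by_cases hw1 : c w = Sum.inl p ∨ c w = Sum.inl q
      · -- both nodes lie on the new string
        have hu2 : ∀ r, c u = Sum.inl r → c r = Sum.inl u := fun r h => hinv hu0 h
        have hw2 : ∀ r, c w = Sum.inl r → c r = Sum.inl w := fun r h => hinv hw0 h
        rcases hu1 with hu1 | hu1 <;> rcases hw1 with hw1 | hw1
        · have : u = w := by
            have := (hu2 p hu1).symm.trans (hw2 p hw1)
            simpa using this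
          subst this
          exact not_crosses_self _ _
        · rw [c1 u hu1, c2 w hw1, hw2 q hw1, hu2 p hu1]
          rw [crosses_comm]
          exact not_crosses_self _ _
        · rw [c2 u hu1, c1 w hw1, hw2 p hw1, hu2 q hu1]
          rw [crosses_comm]
          exact not_crosses_self _ _
        · have : u = w := by
            have := (hu2 q hu1).symm.trans (hw2 q hw1)
            simpa using this
          subst this
          exact not_crosses_self _ _
      · exact (hold hu hw hu1 (fun h => hw1 (Or.inl h)) (fun h => hw1 (Or.inr h))).1
    · have hu3 : c u ≠ Sum.inl p := fun h => hu1 (Or.inl h)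
      have hu4 : c u ≠ Sum.inl q := fun h => hu1 (Or.inr h)
      by_cases hw1 : c w = Sum.inl p ∨ c w = Sum.inl q
      · exact (hold hw hu hw1 hu3 hu4).2
      · rw [c3 u hu3 hu4, c3 w (fun h => hw1 (Or.inl h)) (fun h => hw1 (Or.inr h))]
        exact hc.planar u w hu0 hw0

theorem exists_partial (D E : Diagram n X) : ∀ k, k ≤ n → ∃ c, Partial D E k c
  | 0, _ => ⟨_, partial_zero D E⟩
  | k + 1, hk => by
    obtain ⟨c, hc⟩ := exists_partial D E k (by omega)
    exact partial_succ D E k (by omega) c hc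

theorem adjacentUpTo_self (D E : Diagram n X) : AdjacentUpTo D E n = Adjacent D E := by
  funext p q
  simp [AdjacentUpTo, Adjacent]

theorem free_outer (u : Node n) : Free n (outer u) := by
  rcases u with i | i <;> simp [Free, outer]

theorem outer_injective : Function.Injective (outer (n := n)) := by
  rintro (i | i) (j | j) h <;> simp [outer] at h <;> simp [h]

theorem exists_outer_of_free {p : CNode n} (h : Free n p) : ∃ u, p = outer u := by
  rcases p with (i | i) | (i | i)
  · exact ⟨Sum.inl i, rfl⟩
  · simp [Free] at h; omega
  · simp [Free] at h; omega
  · exact ⟨Sum.inr i, rfl⟩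

theorem cPos_outer (u : Node n) :
    (nodePos u ≤ n + 1 ∧ cPos (outer u) = nodePos u) ∨
      (n + 1 ≤ nodePos u ∧ cPos (outer u) = nodePos u + (2 * n + 1)) := by
  rcases u with i | i
  · refine Or.inr ⟨?_, ?_⟩ <;> simp only [nodePos, cPos, outer] <;> omega
  · refine Or.inl ⟨?_, rfl⟩
    simp only [nodePos]
    omega

theorem bPos_eq (D E : Diagram n X) (p : CNode n) (b : Bdry × X) (h : piece D E p = Sum.inr b) :
    (endPos (n := n) (Sum.inr b) ≤ n + 1 ∧ bPos D E p = endPos (n := n) (Sum.inr b)) ∨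
      (n + 1 ≤ endPos (n := n) (Sum.inr b) ∧
        bPos D E p = endPos (n := n) (Sum.inr b) + (2 * n + 1)) := by
  rcases b with ⟨_ | _, x⟩ <;> rcases p with p | p <;> simp [bPos, h, endPos]
  omega

/-- Every string of the concatenation that starts at an outer node has exactly one other end;
the resulting connections are symmetric, and they can be drawn without crossings. -/
theorem exists_comp (D E : Diagram n X) :
    ∃ F : Diagram n X, ∀ u e, HasEnd D E u e ↔ F.conn u = e := by
  classical
  obtain ⟨c, hc⟩ := exists_partial D E n le_rfl
  have hex : ∀ u, ∃ e, HasEnd D E u e ∧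
      ((nodePos u ≤ n + 1 ∧ cPos (outer u) = nodePos u) ∨
        (n + 1 ≤ nodePos u ∧ cPos (outer u) = nodePos u + (2 * n + 1))) ∧
      ((endPos e ≤ n + 1 ∧ ePos D E (c (outer u)) = endPos e) ∨
        (n + 1 ≤ endPos e ∧ ePos D E (c (outer u)) = endPos e + (2 * n + 1))) := by
    intro u
    rcases h : c (outer u) with p | p
    · obtain ⟨h1, h2, -, h3⟩ := hc.free _ _ (free_outer u) h
      obtain ⟨w, rfl⟩ := exists_outer_of_free h1
      refine ⟨Sum.inl w, ⟨fun e => h2 (e ▸ rfl), ?_⟩, cPos_outer u, cPos_outer w⟩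
      rwa [adjacentUpTo_self] at h3
    · obtain ⟨h1, b, hb⟩ := hc.bdry _ _ (free_outer u) h
      rw [adjacentUpTo_self] at h1
      exact ⟨Sum.inr b, ⟨p, h1, hb⟩, cPos_outer u, bPos_eq D E p b hb⟩
  have huniq : ∀ u e e', HasEnd D E u e → HasEnd D E u e' → e = e' := by
    have key : ∀ u e, HasEnd D E u e →
        (∃ w, e = Sum.inl w ∧ c (outer u) = Sum.inl (outer w)) ∨
        (∃ p b, e = Sum.inr b ∧ c (outer u) = Sum.inr p ∧ piece D E p = Sum.inr b) := by
      rintro u (w | b) h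
      · obtain ⟨h1, h2⟩ := h
        rw [Joined, ← adjacentUpTo_self] at h2
        rcases hc.uniq _ _ (free_outer u) (free_outer w) h2 with h | h
        · exact absurd (outer_injective h) h1
        · exact Or.inl ⟨w, rfl, h⟩
      · obtain ⟨p, h1, h2⟩ := h
        rw [Joined, ← adjacentUpTo_self] at h1
        exact Or.inr ⟨p, b, rfl, hc.uniq' _ _ b (free_outer u) h1 h2, h2⟩
    intro u e e' h h'
    rcases key u e h with ⟨w, rfl, hw⟩ | ⟨p, b, rfl, hp, hb⟩ <;>
      rcases key u e' h' with ⟨w', rfl, hw'⟩ | ⟨p', b', rfl, hp', hb'⟩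
    · rw [hw] at hw'
      simp only [Sum.inl.injEq] at hw'
      rw [outer_injective hw']
    · simp [hw] at hp'
    · simp [hw'] at hp
    · rw [hp] at hp'
      simp only [Sum.inr.injEq] at hp'
      subst hp'
      rw [hb] at hb'
      simpa using hb'
  choose f hf using hex
  refine ⟨⟨f, ?_, ?_, ?_⟩, ?_⟩
  · intro u h
    have := (hf u).1
    rw [h] at this
    exact this.1 rfl
  · intro u w h
    have h1 := (hf u).1
    rw [h] at h1
    exact huniq w _ _ (hf w).1 ⟨h1.1.symm, h1.2.symm⟩
  · intro u w h
    have h1 := hc.planar (outer u) (outer w) (free_outer u) (free_outer w)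
    obtain ⟨-, h2, h3⟩ := hf u
    obtain ⟨-, h4, h5⟩ := hf w
    apply h1
    unfold Crosses at *
    omega
  · intro u e
    exact ⟨fun h => huniq u _ _ (hf u).1 h, fun h => h ▸ (hf u).1⟩

/-- The diagram obtained by concatenating two diagrams and removing all loops and all strings
with both ends on the boundaries. -/
noncomputable def Diagram.comp (D E : Diagram n X) : Diagram n X :=
  (exists_comp D E).choose

/-- The strings of the concatenation are those of the diagram `D.comp E`. -/
theorem hasEnd_iff (D E : Diagram n X) (u : Node n) (e : Node n ⊕ (Bdry × X)) :
    HasEnd D E u e ↔ (D.comp E).conn u = e :=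
  (exists_comp D E).choose_spec u e

/-- A connected component of the concatenation is a loop if it has no ends: it contains no outer
node, and no string that ends on a boundary. -/
def IsLoop (D E : Diagram n X) (s : Quot (Adjacent D E)) : Prop :=
  ∀ p, Quot.mk _ p = s → (∀ u, p ≠ outer u) ∧ ∀ b, piece D E p ≠ Sum.inr b

/-- The number of loops formed by the concatenation. -/
noncomputable def numLoops (D E : Diagram n X) : ℕ :=
  Nat.card {s : Quot (Adjacent D E) // IsLoop D E s}

/-- `p` and `q` are nodes at which two different strings are attached that end on a boundary, and
these boundary ends are the two ends of one string of the concatenation, a boundary arc. -/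
def IsArc (D E : Diagram n X) (p q : CNode n) : Prop :=
  p ≠ q ∧ Joined D E p q ∧ (∃ b, piece D E p = Sum.inr b) ∧ ∃ b, piece D E q = Sum.inr b

/-- The concatenation produces no loops and no boundary arcs. -/
def Clean (D E : Diagram n X) : Prop :=
  (∀ s, ¬ IsLoop D E s) ∧ ∀ p q, ¬ IsArc D E p q

/-- Order, from left to right, of the ends on a given boundary of the strings attached at the
nodes of a diagram.  On the top boundary the strings from the left side come first, the higher
ones further to the left, followed by those from the right side, the lower ones further to the
left.  On the bottom boundary the strings from the left side come first, the lower ones further to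
the left, followed by those from the right side, the higher ones further to the left. -/
def bdryRank : Bdry → Node n → ℕ
  | Bdry.top, Sum.inl i => i
  | Bdry.top, Sum.inr i => 2 * n - i
  | Bdry.bot, Sum.inl i => n - i
  | Bdry.bot, Sum.inr i => n + 1 + i

/-- The same order in a concatenation, where the first diagram is to the left of the second. -/
def cRank (s : Bdry) : CNode n → ℕ
  | Sum.inl v => bdryRank s v
  | Sum.inr v => 2 * n + 1 + bdryRank s v

end Concatenation

/-! ### The label algebra -/

/-- The parameters of the label algebra: `loop` is `β`, the value of a loop; `top a b` is
`α_{a b}`, the value of a boundary arc on the top boundary with left label `a` and right label `b`;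
`bot a b` is `δ_{a b}`, the same for the bottom boundary; `cross a b` is `γ_{a b}`, the value of a
boundary arc with label `a` on the top boundary and label `b` on the bottom boundary. -/
structure Params (R X : Type*) where
  loop : R
  top : X → X → R
  bot : X → X → R
  cross : X → X → R

section Algebra

variable {n : ℕ} {R X : Type*} [CommRing R]

/-- The value of a boundary arc with its ends at the strings attached at `p` and `q`; it is `1`
when the pair is in the wrong order, so that each arc is counted exactly once. -/
def arcValue (P : Params R X) (D E : Diagram n X) (p q : CNode n) : R :=
  match piece D E p, piece D E q with
  | Sum.inr (Bdry.top, a), Sum.inr (Bdry.top, b) =>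
      if cRank Bdry.top p < cRank Bdry.top q then P.top a b else 1
  | Sum.inr (Bdry.bot, a), Sum.inr (Bdry.bot, b) =>
      if cRank Bdry.bot p < cRank Bdry.bot q then P.bot a b else 1
  | Sum.inr (Bdry.top, a), Sum.inr (Bdry.bot, b) => P.cross a b
  | _, _ => 1

open scoped Classical in
/-- The factor produced by the loops and boundary arcs of a concatenation. -/
noncomputable def coeff (P : Params R X) (D E : Diagram n X) : R :=
  P.loop ^ numLoops D E *
    ∏ p : CNode n, ∏ q : CNode n, if IsArc D E p q then arcValue P D E p q else 1

/-- The label algebra with parameters `P`: the free `R`-module on the label diagrams, with the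
multiplication defined below. -/
def LabelAlgebra (n : ℕ) {R X : Type*} [CommRing R] (_ : Params R X) : Type _ :=
  Diagram n X →₀ R

namespace LabelAlgebra

variable (n) (P : Params R X)

noncomputable instance : AddCommGroup (LabelAlgebra n P) :=
  inferInstanceAs (AddCommGroup (Diagram n X →₀ R))

noncomputable instance : Module R (LabelAlgebra n P) :=
  inferInstanceAs (Module R (Diagram n X →₀ R))

/-- The diagrams form a basis of the label algebra. -/
noncomputable def diagramBasis : Module.Basis (Diagram n X) R (LabelAlgebra n P) :=
  Module.Basis.ofRepr (LinearEquiv.refl R (Diagram n X →₀ R))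

variable {n}

/-- A diagram as an element of the label algebra. -/
noncomputable def of (D : Diagram n X) : LabelAlgebra n P := diagramBasis n P D

variable (n)

/-- The bilinear extension of the product of diagrams: concatenate, and replace all loops and
boundary arcs by their values. -/
noncomputable def mulMap : LabelAlgebra n P →ₗ[R] LabelAlgebra n P →ₗ[R] LabelAlgebra n P :=
  (diagramBasis n P).constr R fun D => (diagramBasis n P).constr R fun E =>
    coeff P D E • of P (D.comp E)

noncomputable instance : NonUnitalNonAssocRing (LabelAlgebra n P) where
  mul x y := mulMap n P x y
  left_distrib x y z := map_add (mulMap n P x) y z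
  right_distrib x y z := by
    change mulMap n P (x + y) z = mulMap n P x z + mulMap n P y z
    rw [map_add, LinearMap.add_apply]
  zero_mul x := by
    change mulMap n P 0 x = 0
    rw [map_zero, LinearMap.zero_apply]
  mul_zero x := map_zero (mulMap n P x)

instance : IsScalarTower R (LabelAlgebra n P) (LabelAlgebra n P) where
  smul_assoc r x y := by
    change mulMap n P (r • x) y = r • mulMap n P x y
    rw [map_smul, LinearMap.smul_apply]

instance : SMulCommClass R (LabelAlgebra n P) (LabelAlgebra n P) where
  smul_comm r x y := ((mulMap n P x).map_smul r y).symm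

variable {n}

theorem of_mul_of (D E : Diagram n X) : of P D * of P E = coeff P D E • of P (D.comp E) := by
  change mulMap n P (of P D) (of P E) = _
  simp [mulMap, of]

end LabelAlgebra

end Algebra

/-! ### The generators -/

section Generators

variable {n : ℕ} {X : Type*}

/-- The identity diagram. -/
def one : Diagram n X where
  conn
    | Sum.inl j => Sum.inl (Sum.inr j)
    | Sum.inr j => Sum.inl (Sum.inl j)
  conn_ne := by rintro (j | j) <;> simp
  conn_symm := by rintro (j | j) (k | k) <;> simp [eq_comm]
  planar := by
    rintro (j | j) (k | k) <;> simp only [endPos, nodePos, Crosses] <;> omega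

/-- The diagram `e_{i+1}`: nodes `i` and `i + 1` (counted from `0`) are linked on both sides, and
all other strings go straight across. -/
def e (i : ℕ) (hi : i + 1 < n) : Diagram n X where
  conn
    | Sum.inl j =>
        if (j : ℕ) = i then Sum.inl (Sum.inl ⟨i + 1, hi⟩)
        else if (j : ℕ) = i + 1 then Sum.inl (Sum.inl ⟨i, by omega⟩)
        else Sum.inl (Sum.inr j)
    | Sum.inr j =>
        if (j : ℕ) = i then Sum.inl (Sum.inr ⟨i + 1, hi⟩)
        else if (j : ℕ) = i + 1 then Sum.inl (Sum.inr ⟨i, by omega⟩)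
        else Sum.inl (Sum.inl j)
  conn_ne := by
    rintro (j | j) <;> dsimp only <;> split_ifs <;> simp [Fin.ext_iff] <;> omega
  conn_symm := by
    rintro (j | j) (k | k) <;> dsimp only <;> split_ifs <;> simp [Fin.ext_iff] <;> omega
  planar := by
    rintro (j | j) (k | k) <;> dsimp only <;> split_ifs <;>
      simp only [endPos, nodePos, Crosses] <;> omega

/-- The diagram `f` for the top boundary: the first node on the left and the first node on the
right are connected to the top boundary, with labels `a` and `b`, and all other strings go straight
across. -/
def fTop (a b : X) : Diagram n X where
  conn
    | Sum.inl j => if (j : ℕ) = 0 then Sum.inr (Bdry.top, a) else Sum.inl (Sum.inr j)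
    | Sum.inr j => if (j : ℕ) = 0 then Sum.inr (Bdry.top, b) else Sum.inl (Sum.inl j)
  conn_ne := by
    rintro (j | j) <;> dsimp only <;> split_ifs <;> simp
  conn_symm := by
    rintro (j | j) (k | k) <;> dsimp only <;> split_ifs <;> simp [Fin.ext_iff] <;> omega
  planar := by
    rintro (j | j) (k | k) <;> dsimp only <;> split_ifs <;>
      simp only [endPos, nodePos, Crosses] <;> omega

/-- The diagram `f` for the bottom boundary: the last node on the left and the last node on the
right are connected to the bottom boundary, with labels `a` and `b`, and all other strings go
straight across. -/
def fBot (a b : X) : Diagram n X where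
  conn
    | Sum.inl j => if (j : ℕ) + 1 = n then Sum.inr (Bdry.bot, a) else Sum.inl (Sum.inr j)
    | Sum.inr j => if (j : ℕ) + 1 = n then Sum.inr (Bdry.bot, b) else Sum.inl (Sum.inl j)
  conn_ne := by
    rintro (j | j) <;> dsimp only <;> split_ifs <;> simp
  conn_symm := by
    rintro (j | j) (k | k) <;> dsimp only <;> split_ifs <;> simp [Fin.ext_iff] <;> omega
  planar := by
    rintro (j | j) (k | k) <;> dsimp only <;> split_ifs <;>
      simp only [endPos, nodePos, Crosses] <;> omega

/-- The diagram `w` for which the first node on the left is connected to the top boundary, with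
label `a`, the last node on the right is connected to the bottom boundary, with label `b`, and each
further node on the left is connected to the node on the right that is one step higher. -/
def wTop (a b : X) : Diagram n X where
  conn
    | Sum.inl j =>
        if (j : ℕ) = 0 then Sum.inr (Bdry.top, a) else Sum.inl (Sum.inr ⟨j - 1, by omega⟩)
    | Sum.inr j =>
        if h : (j : ℕ) + 1 = n then Sum.inr (Bdry.bot, b)
        else Sum.inl (Sum.inl ⟨j + 1, by omega⟩)
  conn_ne := by
    rintro (j | j) <;> dsimp only <;> split_ifs <;> simp
  conn_symm := by
    rintro (j | j) (k | k) <;> dsimp only <;> split_ifs <;> simp [Fin.ext_iff] <;> omega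
  planar := by
    rintro (j | j) (k | k) <;> dsimp only <;> split_ifs <;>
      simp only [endPos, nodePos, Crosses] <;> omega

/-- The diagram `w` for which the first node on the right is connected to the top boundary, with
label `a`, the last node on the left is connected to the bottom boundary, with label `b`, and each
further node on the left is connected to the node on the right that is one step lower. -/
def wBot (a b : X) : Diagram n X where
  conn
    | Sum.inl j =>
        if h : (j : ℕ) + 1 = n then Sum.inr (Bdry.bot, b)
        else Sum.inl (Sum.inr ⟨j + 1, by omega⟩)
    | Sum.inr j =>
        if (j : ℕ) = 0 then Sum.inr (Bdry.top, a) else Sum.inl (Sum.inl ⟨j - 1, by omega⟩)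
  conn_ne := by
    rintro (j | j) <;> dsimp only <;> split_ifs <;> simp
  conn_symm := by
    rintro (j | j) (k | k) <;> dsimp only <;> split_ifs <;> simp [Fin.ext_iff] <;> omega
  planar := by
    rintro (j | j) (k | k) <;> dsimp only <;> split_ifs <;>
      simp only [endPos, nodePos, Crosses] <;> omega

/-- The diagrams `W(j)`, `0 ≤ j ≤ n`: `W(0)` and `W(n)` are the two diagrams `w`, and
`W(j) = e_j e_{j-1} ⋯ e_1 W(0)` for `1 ≤ j ≤ n - 1`. -/
noncomputable def W (a b : X) : ℕ → Diagram n X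
  | 0 => wTop a b
  | j + 1 => if h : j + 1 < n then (e j h).comp (W a b j) else wBot a b

variable (n X) in
/-- The diagrams `e_i`, and the diagrams `f` for the top and for the bottom boundary. -/
def evenGenerators : Set (Diagram n X) :=
  {D | (∃ (i : ℕ) (hi : i + 1 < n), D = e i hi) ∨ (∃ a b, D = fTop a b) ∨ ∃ a b, D = fBot a b}

variable (n X) in
/-- All generating diagrams. -/
def generators : Set (Diagram n X) :=
  {D | D = one ∨ (∃ (i : ℕ) (hi : i + 1 < n), D = e i hi) ∨
    (∃ a b, D = fTop a b) ∨ (∃ a b, D = fBot a b) ∨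
    (∃ a b, D = wTop a b) ∨ ∃ a b, D = wBot a b}

/-- The diagram is a product of diagrams from `S` (possibly the empty product, the identity) such
that the concatenations produce no loops and no boundary arcs. -/
inductive IsCleanProduct (S : Set (Diagram n X)) : Diagram n X → Prop
  | one : IsCleanProduct S one
  | of (D : Diagram n X) : D ∈ S → IsCleanProduct S D
  | comp (D E : Diagram n X) : IsCleanProduct S D → IsCleanProduct S E → Clean D E →
      IsCleanProduct S (D.comp E)

/-- The number of strings connecting a node to the boundary `s`. -/
noncomputable def numBdryLinks (s : Bdry) (D : Diagram n X) : ℕ :=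
  Nat.card {v : Node n // ∃ x, D.conn v = Sum.inr (s, x)}

/-- A diagram is even if the number of strings connected to each boundary is even. -/
def IsEven (D : Diagram n X) : Prop :=
  Even (numBdryLinks Bdry.top D) ∧ Even (numBdryLinks Bdry.bot D)

/-- A diagram is odd if the number of strings connected to each boundary is odd. -/
def IsOdd (D : Diagram n X) : Prop :=
  Odd (numBdryLinks Bdry.top D) ∧ Odd (numBdryLinks Bdry.bot D)

end Generators

end LabelAlg

/-!
The proof factors diagrams from the left.  A diagram that is not the identity has a *cup* on its
left side (`exists_cup`): a string between two neighbouring left nodes, or from the first left node to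
the top boundary, or from the last left node to the bottom boundary.  Indeed, if no left node is
linked to another one or to a boundary, then all strings go from the left to the right, and
by planarity they go straight across.

Let the cup lie at the gap `j`, and consider the horizontal line through this gap.  In an even
diagram `D` the number of strings that cross this line is even, so that besides the cup there is
another one (`exists_second_crossing`).  The one next to the cup, from `u` above the line to `v`
below it, lies in the same region as the cup, and both strings can be replaced by strings
from the upper end of the cup to `u` and from its lower end to `v` without a crossing
(`IsNextCrossing.exists_isSurgery`).  This gives a diagram `T` with `D = G T`, where `G` is the
generator `e_j`, `f^top` or `f^bot` that belongs to the gap (`IsNextCrossing.comp_eq`).  The two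
intersections with the line are gone and all others remain, which proves by induction that even
diagrams are products of generators (`isCleanProduct_of_isEven`).

An odd diagram `D` is not the identity, and a cup at the gap `j` is what it needs for a left factor
`W(j)`.  The factor `T` is obtained by removing the cup, shifting the other left nodes, and linking
the first left node to the first node of `D` linked to the top boundary (if `j ≠ 0`), and
the last left node to the first one linked to the bottom boundary (if `j ≠ n`); see
`IsLeftFactor.exists_isLeftQuotient` and `IsLeftFactor.comp_eq`.  Conversely, all strings of `T` but
those at these two left nodes can be read off from the product, and by planarity these two can only
lead to the first nodes linked to the boundaries (`IsShift.comp_injective`).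

That a concatenation produces neither loops nor boundary arcs is always checked by showing that
each of its strings reaches an outer node (`ReachesOuter.clean`).  Then the numbers of boundary
ends add up (`ReachesOuter.numBdryLinks_comp`), which settles all questions of parity.
-/

namespace LabelAlg

variable {n : ℕ} {X : Type*}

/-! ### Strings of a concatenation -/

theorem Joined.symm {D E : Diagram n X} {p q : CNode n} (h : Joined D E p q) : Joined D E q p :=
  Relation.EqvGen.symm _ _ h

theorem Joined.trans {D E : Diagram n X} {p q r : CNode n} (h : Joined D E p q)
    (h' : Joined D E q r) : Joined D E p r :=
  Relation.EqvGen.trans _ _ _ h h'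

theorem Joined.refl (D E : Diagram n X) (p : CNode n) : Joined D E p p :=
  Relation.EqvGen.refl _

theorem joined_inl {D : Diagram n X} (E : Diagram n X) {p q : Node n}
    (h : D.conn p = Sum.inl q) : Joined D E (Sum.inl p) (Sum.inl q) :=
  .rel _ _ (Or.inl (by simp [piece, h]))

theorem joined_inr (D : Diagram n X) {E : Diagram n X} {p q : Node n}
    (h : E.conn p = Sum.inl q) : Joined D E (Sum.inr p) (Sum.inr q) :=
  .rel _ _ (Or.inl (by simp [piece, h]))

theorem joined_mid (D E : Diagram n X) (m : Fin n) :
    Joined D E (Sum.inl (Sum.inr m)) (Sum.inr (Sum.inl m)) :=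
  .rel _ _ (Or.inr ⟨m, rfl, rfl⟩)

/-- A left node of the first diagram that is linked to the right node `m` continues to the left
node `m` of the second diagram. -/
theorem joined_through {D : Diagram n X} (E : Diagram n X) {k m : Fin n}
    (h : D.conn (Sum.inl k) = Sum.inl (Sum.inr m)) :
    Joined D E (outer (Sum.inl k)) (Sum.inr (Sum.inl m)) :=
  (joined_inl E h).trans (joined_mid D E m)

theorem piece_inl_eq {D E : Diagram n X} {v : Node n} {b : Bdry × X} :
    piece D E (Sum.inl v) = Sum.inr b ↔ D.conn v = Sum.inr b := by
  rcases h : D.conn v with w | c <;> simp [piece, h]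

theorem piece_inr_eq {D E : Diagram n X} {v : Node n} {b : Bdry × X} :
    piece D E (Sum.inr v) = Sum.inr b ↔ E.conn v = Sum.inr b := by
  rcases h : E.conn v with w | c <;> simp [piece, h]

theorem comp_eq_of_hasEnd {D E F : Diagram n X} (h : ∀ u, HasEnd D E u (F.conn u)) :
    D.comp E = F := by
  ext1
  funext u
  exact (hasEnd_iff D E u _).1 (h u)

/-- A string of the concatenation that starts at an outer node ends on a boundary at most once. -/
theorem bdryEnd_unique {D E : Diagram n X} {u : Node n} {p q : CNode n} {b c : Bdry × X}
    (hp : Joined D E (outer u) p) (hb : piece D E p = Sum.inr b)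
    (hq : Joined D E (outer u) q) (hc : piece D E q = Sum.inr c) : p = q := by
  obtain ⟨f, hf⟩ := exists_partial D E n le_rfl
  rw [Joined, ← adjacentUpTo_self] at hp hq
  have h1 := hf.uniq' _ _ _ (free_outer u) hp hb
  have h2 := hf.uniq' _ _ _ (free_outer u) hq hc
  rw [h1] at h2
  simpa using h2

/-- Every string of the concatenation reaches an outer node. -/
def ReachesOuter (D E : Diagram n X) : Prop := ∀ p, ∃ u, Joined D E p (outer u)

theorem reachesOuter_of_mid {D E : Diagram n X}
    (h : ∀ m : Fin n, ∃ u, Joined D E (Sum.inr (Sum.inl m)) (outer u)) : ReachesOuter D E := by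
  rintro ((k | m) | (m | k))
  · exact ⟨Sum.inl k, .refl _ _ _⟩
  · obtain ⟨u, hu⟩ := h m
    exact ⟨u, (joined_mid D E m).trans hu⟩
  · exact h m
  · exact ⟨Sum.inr k, .refl _ _ _⟩

/-- A loop has no outer node, and a boundary arc would be a second boundary end of a string that
starts at an outer node. -/
theorem ReachesOuter.clean {D E : Diagram n X} (h : ReachesOuter D E) : Clean D E := by
  refine ⟨fun s hs => ?_, ?_⟩
  · obtain ⟨p, rfl⟩ := Quot.exists_rep s
    obtain ⟨u, hu⟩ := h p
    exact (hs (outer u) (Quot.eqvGen_sound hu).symm).1 u rfl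
  · rintro p q ⟨hpq, hj, ⟨b, hb⟩, ⟨c, hc⟩⟩
    obtain ⟨u, hu⟩ := h p
    exact hpq (bdryEnd_unique hu.symm hb (hu.symm.trans hj) hc)

/-- If every string reaches an outer node, every boundary end of the two diagrams survives in the
concatenation. -/
theorem ReachesOuter.numBdryLinks_comp {D E : Diagram n X} (h : ReachesOuter D E) (s : Bdry) :
    numBdryLinks s (D.comp E) = numBdryLinks s D + numBdryLinks s E := by
  choose o ho using h
  have h1 : Nat.card {p : CNode n // ∃ x, piece D E p = Sum.inr (s, x)} =
      numBdryLinks s (D.comp E) := by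
    have hend : ∀ (p : CNode n) (x : X), piece D E p = Sum.inr (s, x) →
        (D.comp E).conn (o p) = Sum.inr (s, x) :=
      fun p x hx => (hasEnd_iff D E _ _).1 ⟨p, (ho p).symm, hx⟩
    refine Nat.card_eq_of_bijective
      (fun p => ⟨o p.1, p.2.imp fun x hx => hend p.1 x hx⟩) ⟨?_, ?_⟩
    · rintro ⟨p, x, hx⟩ ⟨q, y, hy⟩ hpq
      simp only [Subtype.mk.injEq] at hpq ⊢
      exact bdryEnd_unique (ho p).symm hx (hpq ▸ (ho q).symm) hy
    · rintro ⟨v, x, hx⟩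
      obtain ⟨p, hp, hpx⟩ := (hasEnd_iff D E v _).2 hx
      refine ⟨⟨p, x, hpx⟩, Subtype.ext ?_⟩
      by_contra hne
      have : (D.comp E).conn v = Sum.inl (o p) :=
        (hasEnd_iff D E v _).1 ⟨hne, hp.trans (ho p)⟩
      rw [hx] at this
      simp at this
  rw [← h1, Nat.card_congr (Equiv.subtypeSum), Nat.card_sum]
  simp only [piece_inl_eq, piece_inr_eq, numBdryLinks]

/-! ### Parity of the number of boundary ends -/

/-- The strings pair up the nodes of a set that is closed under passing to the other end. -/
theorem even_card_of_conn_mem (D : Diagram n X) (S : Finset (Node n))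
    (h : ∀ v ∈ S, ∃ w ∈ S, D.conn v = Sum.inl w) : Even S.card := by
  classical
  have h0 : ∑ _v ∈ S, (1 : ZMod 2) = 0 := by
    refine Finset.sum_involution (fun v hv => (h v hv).choose) ?_ ?_ ?_ ?_
    · intro v hv
      decide
    · intro v hv _ hne
      have := (h v hv).choose_spec.2
      rw [hne] at this
      exact D.conn_ne v this
    · intro v hv
      exact (h v hv).choose_spec.1
    · intro v hv
      have h1 := (h v hv).choose_spec
      have h2 := (h _ h1.1).choose_spec.2
      exact Sum.inl.inj (h2.symm.trans (D.conn_symm _ _ h1.2))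
  rw [Finset.sum_const, nsmul_eq_mul, mul_one, ZMod.natCast_eq_zero_iff] at h0
  exact even_iff_two_dvd.2 h0

open scoped Classical in
theorem numBdryLinks_eq_card (s : Bdry) (D : Diagram n X) :
    numBdryLinks s D =
      (Finset.univ.filter fun v : Node n => ∃ x, D.conn v = Sum.inr (s, x)).card := by
  rw [numBdryLinks, Nat.card_eq_fintype_card, Fintype.card_subtype]

theorem isEven_or_isOdd (D : Diagram n X) : IsEven D ∨ IsOdd D := by
  classical
  have h1 := even_card_of_conn_mem D
    (Finset.univ.filter fun v : Node n => ∃ w, D.conn v = Sum.inl w) (by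
      simp only [Finset.mem_filter, Finset.mem_univ, true_and]
      rintro v ⟨w, hw⟩
      exact ⟨w, ⟨v, D.conn_symm _ _ hw⟩, hw⟩)
  have h2 : (Finset.univ : Finset (Node n)) =
      (Finset.univ.filter fun v : Node n => ∃ w, D.conn v = Sum.inl w) ∪
      ((Finset.univ.filter fun v : Node n => ∃ x, D.conn v = Sum.inr (Bdry.top, x)) ∪
      (Finset.univ.filter fun v : Node n => ∃ x, D.conn v = Sum.inr (Bdry.bot, x))) := by
    ext v
    simp only [Finset.mem_univ, Finset.mem_union, Finset.mem_filter, true_and, true_iff]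
    rcases h : D.conn v with w | ⟨_ | _, x⟩
    · exact Or.inl ⟨w, rfl⟩
    · exact Or.inr (Or.inl ⟨x, rfl⟩)
    · exact Or.inr (Or.inr ⟨x, rfl⟩)
  have h3 := congrArg Finset.card h2
  rw [Finset.card_union_of_disjoint, Finset.card_union_of_disjoint, ← numBdryLinks_eq_card,
    ← numBdryLinks_eq_card, Finset.card_univ, Fintype.card_sum, Fintype.card_fin] at h3
  · have h4 : Even (numBdryLinks Bdry.top D + numBdryLinks Bdry.bot D) := by
      obtain ⟨r, hr⟩ := h1
      exact ⟨n - r, by omega⟩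
    rw [Nat.even_add] at h4
    by_cases h5 : Even (numBdryLinks Bdry.top D)
    · exact Or.inl ⟨h5, h4.1 h5⟩
    · exact Or.inr ⟨Nat.not_even_iff_odd.1 h5, Nat.not_even_iff_odd.1 fun h => h5 (h4.2 h)⟩
  · rw [Finset.disjoint_filter]
    rintro v - ⟨x, hx⟩ ⟨y, hy⟩
    rw [hx] at hy
    simp at hy
  · rw [Finset.disjoint_union_right, Finset.disjoint_filter, Finset.disjoint_filter]
    constructor <;>
    · rintro v - ⟨x, hx⟩ ⟨y, hy⟩
      rw [hx] at hy
      simp at hy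

/-! ### Strings, heights and cups -/

/-- The diagram `D` has a string with ends `s` and `t`. -/
def IsString (D : Diagram n X) (s t : Node n ⊕ (Bdry × X)) : Prop :=
  (∃ v, s = Sum.inl v ∧ D.conn v = t) ∨ ∃ v, t = Sum.inl v ∧ D.conn v = s

theorem isString_conn (D : Diagram n X) (v : Node n) : IsString D (Sum.inl v) (D.conn v) :=
  Or.inl ⟨v, rfl, rfl⟩

theorem IsString.symm {D : Diagram n X} {s t : Node n ⊕ (Bdry × X)} (h : IsString D s t) :
    IsString D t s :=
  Or.symm h

theorem IsString.conn_eq {D : Diagram n X} {v : Node n} {t : Node n ⊕ (Bdry × X)}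
    (h : IsString D (Sum.inl v) t) : D.conn v = t := by
  rcases h with ⟨w, hw, h⟩ | ⟨w, rfl, h⟩
  · obtain rfl : v = w := by simpa using hw
    exact h
  · exact D.conn_symm _ _ h

theorem IsString.not_bdry {D : Diagram n X} {b c : Bdry × X}
    (h : IsString D (Sum.inr b) (Sum.inr c)) : False := by
  rcases h with ⟨w, hw, -⟩ | ⟨w, hw, -⟩ <;> simp at hw

theorem IsString.not_crosses {D : Diagram n X} {s t s' t' : Node n ⊕ (Bdry × X)}
    (h : IsString D s t) (h' : IsString D s' t') :
    ¬ Crosses (endPos s) (endPos t) (endPos s') (endPos t') := by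
  rcases h with ⟨v, rfl, rfl⟩ | ⟨v, rfl, rfl⟩ <;> rcases h' with ⟨w, rfl, rfl⟩ | ⟨w, rfl, rfl⟩
  · exact D.planar v w
  · rw [crosses_comm']; exact D.planar v w
  · rw [crosses_comm]; exact D.planar v w
  · rw [crosses_comm, crosses_comm']; exact D.planar v w

/-- The height of a string end, counted downwards: `0` for the top boundary, `k + 1` for the
nodes in row `k`, and `n + 1` for the bottom boundary.  The horizontal line through the gap `j`
separates the ends of height at most `j` from the others. -/
def height : Node n ⊕ (Bdry × X) → ℕ
  | Sum.inl (Sum.inl i) => i + 1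
  | Sum.inl (Sum.inr i) => i + 1
  | Sum.inr (Bdry.top, _) => 0
  | Sum.inr (Bdry.bot, _) => n + 1

theorem height_le_iff {j : ℕ} (hj : j ≤ n) (s : Node n ⊕ (Bdry × X)) :
    height s ≤ j ↔ endPos s ≤ j ∨ 2 * n + 2 ≤ endPos s + j := by
  rcases s with (i | i) | ⟨_ | _, x⟩ <;> simp only [height, endPos, nodePos] <;> omega

/-- `s` is the end just above the gap `j` on the side `ι` (one of `Sum.inl` and `Sum.inr`): the
node in row `j - 1`, or an end on the top boundary if `j = 0`. -/
def IsAbove (ι : Fin n → Node n) (j : ℕ) (s : Node n ⊕ (Bdry × X)) : Prop :=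
  (∃ k : Fin n, (k : ℕ) + 1 = j ∧ s = Sum.inl (ι k)) ∨ (j = 0 ∧ ∃ a, s = Sum.inr (Bdry.top, a))

/-- `s` is the end just below the gap `j` on the side `ι`: the node in row `j`, or an end on the
bottom boundary if `j = n`. -/
def IsBelow (ι : Fin n → Node n) (j : ℕ) (s : Node n ⊕ (Bdry × X)) : Prop :=
  (∃ k : Fin n, (k : ℕ) = j ∧ s = Sum.inl (ι k)) ∨ (j = n ∧ ∃ a, s = Sum.inr (Bdry.bot, a))

/-- A string of `D` that starts and ends on the left side contains a cup between neighbours. -/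
theorem exists_cup_of_left_left (D : Diagram n X) (d : ℕ) :
    ∀ k l : Fin n, (l : ℕ) = k + 1 + d → D.conn (Sum.inl k) = Sum.inl (Sum.inl l) →
    ∃ k l : Fin n, (l : ℕ) = k + 1 ∧ D.conn (Sum.inl k) = Sum.inl (Sum.inl l) := by
  induction d using Nat.strong_induction_on with
  | _ d ih =>
    intro k l hkl h
    rcases Nat.eq_zero_or_pos d with rfl | hd
    · exact ⟨k, l, hkl, h⟩
    · have hk : (k : ℕ) + 1 < n := by omega
      have h1 := D.planar (Sum.inl ⟨k + 1, hk⟩) (Sum.inl k)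
      have h2 := D.planar (Sum.inl k) (Sum.inl ⟨k + 1, hk⟩)
      have hne := D.conn_ne (Sum.inl ⟨k + 1, hk⟩)
      rw [h] at h1 h2
      rcases h3 : D.conn (Sum.inl ⟨k + 1, hk⟩) with (m | m) | ⟨_ | _, x⟩ <;> rw [h3] at h1 h2 hne
      · have hmk : m ≠ k := by
          rintro rfl
          have := D.conn_symm _ _ h3
          rw [h] at this
          simp only [Sum.inl.injEq] at this
          have := congrArg Fin.val this
          simp at this
          omega
        have hml : m ≠ l := by
          rintro rfl
          have := D.conn_symm _ _ h3
          rw [D.conn_symm _ _ h] at this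
          simp only [Sum.inl.injEq] at this
          have := congrArg Fin.val this
          simp at this
        simp only [ne_eq, Sum.inl.injEq, Fin.ext_iff] at hne hmk hml
        simp only [endPos, nodePos, Crosses] at h1 h2
        exact ih (m - (k + 2)) (by omega) ⟨k + 1, hk⟩ m (by simp only; omega) h3
      all_goals
        simp only [endPos, nodePos, Crosses] at h1 h2
        omega

/-- A diagram other than the identity has a cup on its left side. -/
theorem exists_cup (D : Diagram n X) (hD : D ≠ one) :
    ∃ j s t, j ≤ n ∧ IsAbove Sum.inl j s ∧ IsBelow Sum.inl j t ∧ IsString D s t := by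
  by_contra hno
  have hll : ∀ k l : Fin n, D.conn (Sum.inl k) ≠ Sum.inl (Sum.inl l) := by
    have key : ∀ k l : Fin n, k < l → D.conn (Sum.inl k) ≠ Sum.inl (Sum.inl l) := by
      intro k l hkl h
      rw [Fin.lt_def] at hkl
      obtain ⟨k, l, h1, h2⟩ := exists_cup_of_left_left D (l - (k + 1)) k l (by omega) h
      exact hno ⟨l, _, _, l.2.le, Or.inl ⟨k, h1.symm, rfl⟩, Or.inl ⟨l, rfl, rfl⟩,
        Or.inl ⟨_, rfl, h2⟩⟩
    intro k l h
    rcases lt_trichotomy k l with hkl | rfl | hkl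
    · exact key k l hkl h
    · exact D.conn_ne _ h
    · exact key l k hkl (D.conn_symm _ _ h)
  have htop : ∀ (k : Fin n) a, D.conn (Sum.inl k) ≠ Sum.inr (Bdry.top, a) := by
    intro k a h
    have hn : 0 < n := k.pos
    rcases h0 : D.conn (Sum.inl ⟨0, hn⟩) with (m | m) | ⟨_ | _, x⟩
    · exact hll _ _ h0
    · have := D.planar (Sum.inl k) (Sum.inl ⟨0, hn⟩)
      have hk : (k : ℕ) ≠ 0 := by
        intro hk
        rw [show (⟨0, hn⟩ : Fin n) = k from Fin.ext hk.symm, h] at h0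
        simp at h0
      rw [h, h0] at this
      simp only [endPos, nodePos, Crosses] at this
      omega
    · exact hno ⟨0, _, _, by omega, Or.inr ⟨rfl, x, rfl⟩, Or.inl ⟨⟨0, hn⟩, rfl, rfl⟩,
        Or.inr ⟨_, rfl, h0⟩⟩
    · have := D.planar (Sum.inl k) (Sum.inl ⟨0, hn⟩)
      have hk : (k : ℕ) ≠ 0 := by
        intro hk
        rw [show (⟨0, hn⟩ : Fin n) = k from Fin.ext hk.symm, h] at h0
        simp at h0
      rw [h, h0] at this
      simp only [endPos, nodePos, Crosses] at this
      omega
  have hbot : ∀ (k : Fin n) a, D.conn (Sum.inl k) ≠ Sum.inr (Bdry.bot, a) := by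
    intro k a h
    have hn : n - 1 < n := Nat.sub_lt k.pos one_pos
    rcases h0 : D.conn (Sum.inl ⟨n - 1, hn⟩) with (m | m) | ⟨_ | _, x⟩
    · exact hll _ _ h0
    · have := D.planar (Sum.inl ⟨n - 1, hn⟩) (Sum.inl k)
      have hk : (k : ℕ) ≠ n - 1 := by
        intro hk
        rw [show (⟨n - 1, hn⟩ : Fin n) = k from Fin.ext hk.symm, h] at h0
        simp at h0
      rw [h, h0] at this
      simp only [endPos, nodePos, Crosses] at this
      omega
    · exact htop _ _ h0
    · exact hno ⟨n, _, _, le_rfl, Or.inl ⟨⟨n - 1, hn⟩, by simp only; omega, rfl⟩,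
        Or.inr ⟨rfl, x, rfl⟩, Or.inl ⟨_, rfl, h0⟩⟩
  have hthrough : ∀ k : Fin n, ∃ m, D.conn (Sum.inl k) = Sum.inl (Sum.inr m) := by
    intro k
    rcases h0 : D.conn (Sum.inl k) with (m | m) | ⟨_ | _, x⟩
    · exact absurd h0 (hll _ _)
    · exact ⟨m, rfl⟩
    · exact absurd h0 (htop _ _)
    · exact absurd h0 (hbot _ _)
  choose f hf using hthrough
  have hmono : StrictMono f := by
    intro k l hkl
    have h1 := D.planar (Sum.inl l) (Sum.inl k)
    have h2 := D.planar (Sum.inl k) (Sum.inl l)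
    have h3 : f k ≠ f l := by
      intro he
      have h4 := D.conn_symm _ _ (hf k)
      rw [he, D.conn_symm _ _ (hf l)] at h4
      simp only [Sum.inl.injEq] at h4
      exact hkl.ne h4.symm
    rw [hf, hf] at h1 h2
    simp only [endPos, nodePos, Crosses] at h1 h2
    rw [Ne, Fin.ext_iff] at h3
    rw [Fin.lt_def] at hkl ⊢
    omega
  have hid : ∀ k, f k = k := fun k => le_antisymm hmono.apply_le hmono.le_apply
  apply hD
  ext1
  funext v
  rcases v with k | k
  · rw [hf, hid]; rfl
  · have := D.conn_symm _ _ (hf k)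
    rw [hid] at this
    rw [this]; rfl

/-- In an even diagram with a cup at the gap `j`, another string crosses the horizontal line
through this gap, since the number of these strings is even. -/
theorem exists_second_crossing {D : Diagram n X} (hD : IsEven D) {j : ℕ} (hj : j ≤ n)
    {A B : Node n ⊕ (Bdry × X)} (hA : IsAbove Sum.inl j A) (hB : IsBelow Sum.inl j B)
    (hAB : IsString D A B) :
    ∃ s t, IsString D s t ∧ height s ≤ j ∧ j < height t ∧ ¬ (s = A ∧ t = B) := by
  classical
  -- the argument at one of the two boundaries
  have hb : ∀ (s : Bdry) (k : Fin n) a, D.conn (Sum.inl k) = Sum.inr (s, a) →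
      ∃ v b, D.conn v = Sum.inr (s, b) ∧ v ≠ Sum.inl k := by
    intro s k a h
    by_contra hno
    push Not at hno
    have hone : numBdryLinks s D = 1 := by
      rw [numBdryLinks_eq_card, Finset.card_eq_one]
      refine ⟨Sum.inl k, ?_⟩
      ext v
      simp only [Finset.mem_filter, Finset.mem_univ, true_and, Finset.mem_singleton]
      exact ⟨fun ⟨b, hb⟩ => hno v b hb, fun hv => ⟨a, hv ▸ h⟩⟩
    have : Even (numBdryLinks s D) := by cases s <;> [exact hD.1; exact hD.2]
    rw [hone] at this
    exact Nat.not_even_one this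
  rcases hA with ⟨k, hk, rfl⟩ | ⟨rfl, a, rfl⟩ <;> rcases hB with ⟨l, hl, rfl⟩ | ⟨h, c, rfl⟩
  · by_contra hno
    push Not at hno
    have hkl : D.conn (Sum.inl k) = Sum.inl (Sum.inl l) := hAB.conn_eq
    have hcross : ∀ v : Node n, height (X := X) (Sum.inl v) ≤ j → j < height (D.conn v) →
        v = Sum.inl k := by
      intro v h1 h2
      simpa using (hno _ _ (isString_conn D v) h1 h2).1
    have htop : ∀ (v : Node n) a, D.conn v = Sum.inr (Bdry.top, a) →
        height (X := X) (Sum.inl v) ≤ j := by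
      intro v a h
      by_contra h1
      have := (hno _ _ (isString_conn D v).symm (by rw [h]; simp [height]) (by omega)).1
      rw [h] at this
      simp at this
    let U : Finset (Node n) := Finset.univ.filter fun v => height (X := X) (Sum.inl v) ≤ j
    let V : Finset (Node n) := Finset.univ.filter fun v => ∃ x, D.conn v = Sum.inr (Bdry.top, x)
    have hmem : ∀ v, v ∈ U ↔ height (X := X) (Sum.inl v) ≤ j := fun v => by simp [U]
    have hU : Even U.card := by
      refine even_card_of_conn_mem (one : Diagram n X) U ?_
      rintro (i | i) hi
      · exact ⟨Sum.inr i, (hmem _).2 (by exact (hmem (Sum.inl i)).1 hi), rfl⟩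
      · exact ⟨Sum.inl i, (hmem _).2 (by exact (hmem (Sum.inr i)).1 hi), rfl⟩
    have hV : Even V.card := by
      have := hD.1
      rwa [numBdryLinks_eq_card] at this
    have hkU : Sum.inl k ∈ U := (hmem _).2 (by simp only [height]; omega)
    have hkV : Sum.inl k ∉ V := by simp [V, hkl]
    have hVU : insert (Sum.inl k) V ⊆ U := by
      intro v hv
      rw [Finset.mem_insert] at hv
      rcases hv with rfl | hv
      · exact hkU
      · simp only [V, U, Finset.mem_filter, Finset.mem_univ, true_and] at hv ⊢
        obtain ⟨x, hx⟩ := hv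
        exact htop v x hx
    have hrest : Even (U \ insert (Sum.inl k) V).card := by
      refine even_card_of_conn_mem D _ ?_
      intro v hv
      simp only [U, V, Finset.mem_sdiff, Finset.mem_insert, Finset.mem_filter, Finset.mem_univ,
        true_and, not_or, not_exists] at hv ⊢
      obtain ⟨hv1, hv2, hv3⟩ := hv
      have hlow : height (D.conn v) ≤ j := by
        by_contra h
        exact hv2 (hcross v hv1 (by omega))
      rcases hw : D.conn v with w | ⟨_ | _, x⟩
      · have hwv := D.conn_symm _ _ hw
        refine ⟨w, ⟨by rwa [hw] at hlow, ?_, by simp [hwv]⟩, rfl⟩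
        rintro rfl
        rw [hkl] at hwv
        simp only [Sum.inl.injEq] at hwv
        subst hwv
        simp [height] at hv1
        omega
      · exact absurd hw (hv3 x)
      · rw [hw] at hlow
        simp [height] at hlow
        omega
    have hcard := Finset.card_sdiff_add_card_eq_card hVU
    rw [Finset.card_insert_of_notMem hkV] at hcard
    rw [Nat.even_iff] at *
    omega
  · obtain ⟨v, b, hv, hne⟩ := hb _ _ _ hAB.conn_eq
    refine ⟨Sum.inl v, _, isString_conn D v, ?_, ?_, ?_⟩
    · rcases v with i | i <;> simp only [height] <;> omega
    · rw [hv]; simp only [height]; omega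
    · rintro ⟨h1, -⟩
      exact hne (by simpa using h1)
  · obtain ⟨v, b, hv, hne⟩ := hb _ _ _ hAB.symm.conn_eq
    refine ⟨_, Sum.inl v, (isString_conn D v).symm, ?_, ?_, ?_⟩
    · rw [hv]; simp only [height]; omega
    · rcases v with i | i <;> simp only [height] <;> omega
    · rintro ⟨-, h1⟩
      exact hne (by simpa using h1)
  · exact hAB.not_bdry.elim

/-! ### Surgery at a cup -/

/-- Distance of a crossing string from the left end of the gap `j`, when its upper end is at the
position `p` and its lower end at the position `q` of the perimeter: the number of steps along the
perimeter from the gap clockwise to `p` plus the number of steps counterclockwise to `q`. -/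
def crossingDist (n j p q : ℕ) : ℕ :=
  (if p + j < 2 * n + 2 then p + j else p + j - (2 * n + 2)) + (2 * n + 1 - j - q)

/-- Let the string from `u` to `v` cross the line through the gap `j` next to the left end of the
gap, and let another string from `p` to `q` not cross the former one.  Then the latter also does not
cross the strings to `u` and to `v` from the left nodes just above and just below the gap: such a
crossing would make it a string across the line that lies further to the left. -/
theorem not_crosses_surgery {n j u v p q : ℕ} (hj : j ≤ n)
    (hu : u ≤ j ∨ 2 * n + 2 ≤ u + j) (hu' : u ≤ 2 * n + 1)
    (hv : ¬ (v ≤ j ∨ 2 * n + 2 ≤ v + j))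
    (hp : p ≤ 2 * n + 1) (hq : q ≤ 2 * n + 1)
    (h1 : ¬ Crosses u v p q) (h2 : ¬ Crosses p q u v)
    (hm : p ≤ j ∨ 2 * n + 2 ≤ p + j → ¬ (q ≤ j ∨ 2 * n + 2 ≤ q + j) →
      crossingDist n j u v ≤ crossingDist n j p q)
    (hm' : q ≤ j ∨ 2 * n + 2 ≤ q + j → ¬ (p ≤ j ∨ 2 * n + 2 ≤ p + j) →
      crossingDist n j u v ≤ crossingDist n j q p) :
    (¬ Crosses (2 * n + 2 - j) u p q ∧ ¬ Crosses p q (2 * n + 2 - j) u) ∧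
      ¬ Crosses (2 * n + 1 - j) v p q ∧ ¬ Crosses p q (2 * n + 1 - j) v := by
  wlog hpq : p ≤ q generalizing p q
  · have := this hq hp (by rwa [crosses_comm']) (by rwa [crosses_comm]) hm' hm (by omega)
    rwa [crosses_comm', crosses_comm' (2 * n + 1 - j), crosses_comm q p,
      crosses_comm q p] at this
  unfold crossingDist at hm hm'
  unfold Crosses at *
  rw [min_eq_left hpq, max_eq_right hpq] at *
  rw [not_or, not_le, not_le] at hv
  refine ⟨⟨?_, ?_⟩, ?_, ?_⟩ <;> rcases hu with hu | hu
  all_goals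
    split_ifs at hm hm' <;> omega

theorem IsAbove.height_eq {ι : Fin n → Node n} (hι : ι = Sum.inl ∨ ι = Sum.inr) {j : ℕ}
    {s : Node n ⊕ (Bdry × X)} (h : IsAbove ι j s) : height s = j := by
  rcases h with ⟨k, hk, rfl⟩ | ⟨rfl, a, rfl⟩
  · rcases hι with rfl | rfl <;> simpa [height] using hk
  · rfl

theorem IsBelow.height_eq {ι : Fin n → Node n} (hι : ι = Sum.inl ∨ ι = Sum.inr) {j : ℕ}
    {s : Node n ⊕ (Bdry × X)} (h : IsBelow ι j s) : height s = j + 1 := by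
  rcases h with ⟨k, hk, rfl⟩ | ⟨rfl, a, rfl⟩
  · rcases hι with rfl | rfl <;> simpa [height] using hk
  · rfl

theorem IsAbove.endPos_eq {j : ℕ} {v : Node n}
    (h : IsAbove (X := X) Sum.inl j (Sum.inl v)) : nodePos v = 2 * n + 2 - j := by
  rcases h with ⟨k, hk, h⟩ | ⟨-, a, h⟩
  · obtain rfl : v = Sum.inl k := by simpa using h
    simp only [nodePos]; omega
  · simp at h

theorem IsBelow.endPos_eq {j : ℕ} {s : Node n ⊕ (Bdry × X)}
    (h : IsBelow Sum.inl j s) : endPos s = 2 * n + 1 - j := by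
  rcases h with ⟨k, hk, rfl⟩ | ⟨rfl, a, rfl⟩ <;> simp only [endPos, nodePos] <;> omega

/-- The diagram `T` arises from `D` by replacing the string from `A` to `B` and the string from `u`
to `v` by strings from `A` to `u` and from `B` to `v`; a new string between two boundary ends is
dropped. -/
structure IsSurgery (D T : Diagram n X) (A B u v : Node n ⊕ (Bdry × X)) : Prop where
  conn_A : ∀ x, Sum.inl x = A → T.conn x = u
  conn_B : ∀ x, Sum.inl x = B → T.conn x = v
  conn_u : ∀ x, Sum.inl x = u → T.conn x = A
  conn_v : ∀ x, Sum.inl x = v → T.conn x = B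
  conn_other : ∀ x, Sum.inl x ≠ A → Sum.inl x ≠ B → Sum.inl x ≠ u → Sum.inl x ≠ v →
    T.conn x = D.conn x

/-- A string with ends `u` and `v` crosses the line through the gap `j` as close as possible to the
cup from `A` to `B` on the left side of this gap. -/
structure IsNextCrossing (D : Diagram n X) (j : ℕ) (A B u v : Node n ⊕ (Bdry × X)) : Prop where
  le : j ≤ n
  above : IsAbove Sum.inl j A
  below : IsBelow Sum.inl j B
  cup : IsString D A B
  string : IsString D u v
  height_le : height u ≤ j
  lt_height : j < height v
  ne : ¬ (u = A ∧ v = B)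
  closest : ∀ s t, IsString D s t → height s ≤ j → j < height t → ¬ (s = A ∧ t = B) →
    crossingDist n j (endPos u) (endPos v) ≤ crossingDist n j (endPos s) (endPos t)

/-- The next crossing string minimizes the distance from the left end of the gap; it exists by
parity. -/
theorem exists_isNextCrossing {D : Diagram n X} (hD : IsEven D) {j : ℕ} (hj : j ≤ n)
    {A B : Node n ⊕ (Bdry × X)} (hA : IsAbove Sum.inl j A) (hB : IsBelow Sum.inl j B)
    (hAB : IsString D A B) : ∃ u v, IsNextCrossing D j A B u v := by
  classical
  have hex : ∃ d s t, IsString D s t ∧ height s ≤ j ∧ j < height t ∧ ¬ (s = A ∧ t = B) ∧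
      crossingDist n j (endPos s) (endPos t) = d := by
    obtain ⟨s, t, h1, h2, h3, h4⟩ := exists_second_crossing hD hj hA hB hAB
    exact ⟨_, s, t, h1, h2, h3, h4, rfl⟩
  obtain ⟨u, v, h1, h2, h3, h4, h5⟩ := Nat.find_spec hex
  refine ⟨u, v, hj, hA, hB, hAB, h1, h2, h3, h4, ?_⟩
  intro s t hs1 hs2 hs3 hs4
  rw [h5]
  exact Nat.find_min' hex ⟨s, t, hs1, hs2, hs3, hs4, rfl⟩

namespace IsNextCrossing

variable {D : Diagram n X} {j : ℕ} {A B u v : Node n ⊕ (Bdry × X)}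

theorem height_A (h : IsNextCrossing D j A B u v) : height A = j := h.above.height_eq (Or.inl rfl)

theorem height_B (h : IsNextCrossing D j A B u v) : height B = j + 1 :=
  h.below.height_eq (Or.inl rfl)

theorem A_ne_B (h : IsNextCrossing D j A B u v) : A ≠ B := by
  rintro rfl
  have := h.height_A
  have := h.height_B
  omega

theorem A_ne_v (h : IsNextCrossing D j A B u v) : A ≠ v := by
  rintro rfl
  have := h.height_A
  have := h.lt_height
  omega

theorem u_ne_B (h : IsNextCrossing D j A B u v) : u ≠ B := by
  rintro rfl
  have := h.height_B
  have := h.height_le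
  omega

theorem u_ne_v (h : IsNextCrossing D j A B u v) : u ≠ v := by
  rintro rfl
  have := h.lt_height
  have := h.height_le
  omega

theorem ne_u_of_eq_A (h : IsNextCrossing D j A B u v) {x : Node n} (hx : Sum.inl x = A) :
    Sum.inl x ≠ u := by
  intro hu
  have h1 := h.string
  have h2 := h.cup
  rw [← hu] at h1
  rw [← hx] at h2
  exact h.ne ⟨hu.symm.trans hx, h1.conn_eq.symm.trans h2.conn_eq⟩

theorem ne_v_of_eq_B (h : IsNextCrossing D j A B u v) {x : Node n} (hx : Sum.inl x = B) :
    Sum.inl x ≠ v := by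
  intro hv
  have h1 := h.string.symm
  have h2 := h.cup.symm
  rw [← hv] at h1
  rw [← hx] at h2
  exact h.ne ⟨h1.conn_eq.symm.trans h2.conn_eq, hv.symm.trans hx⟩

/-- The other end of a string of `D` away from the surgery is away from the surgery. -/
theorem conn_ne_of_ne (h : IsNextCrossing D j A B u v) {x w : Node n}
    (hA : Sum.inl x ≠ A) (hB : Sum.inl x ≠ B) (hu : Sum.inl x ≠ u) (hv : Sum.inl x ≠ v)
    (hw : D.conn x = Sum.inl w) :
    Sum.inl w ≠ A ∧ Sum.inl w ≠ B ∧ Sum.inl w ≠ u ∧ Sum.inl w ≠ v := by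
  have hw' := D.conn_symm _ _ hw
  have key : ∀ s t : Node n ⊕ (Bdry × X), IsString D s t → Sum.inl x ≠ t → Sum.inl w ≠ s := by
    rintro s t hst hxt rfl
    exact hxt (hw'.symm.trans hst.conn_eq)
  exact ⟨key _ _ h.cup hB, key _ _ h.cup.symm hA, key _ _ h.string hv, key _ _ h.string.symm hu⟩

/-- The surgery yields a diagram again, that is, it keeps the strings from crossing. -/
theorem exists_isSurgery (h : IsNextCrossing D j A B u v) : ∃ T, IsSurgery D T A B u v := by
  classical
  let f : Node n → Node n ⊕ (Bdry × X) := fun x =>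
    if Sum.inl x = A then u else if Sum.inl x = B then v else
    if Sum.inl x = u then A else if Sum.inl x = v then B else D.conn x
  have fA : ∀ x, Sum.inl x = A → f x = u := fun x hx => if_pos hx
  have fB : ∀ x, Sum.inl x = B → f x = v := fun x hx => by
    simp only [f]
    rw [if_neg (fun h1 => h.A_ne_B (h1.symm.trans hx)), if_pos hx]
  have fu : ∀ x, Sum.inl x = u → f x = A := fun x hx => by
    simp only [f]
    rw [if_neg (fun h1 => h.ne_u_of_eq_A h1 hx), if_neg (fun h1 => h.u_ne_B (hx.symm.trans h1)),
      if_pos hx]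
  have fv : ∀ x, Sum.inl x = v → f x = B := fun x hx => by
    simp only [f]
    rw [if_neg (fun h1 => h.A_ne_v (h1.symm.trans hx)), if_neg (fun h1 => h.ne_v_of_eq_B h1 hx),
      if_neg (fun h1 => h.u_ne_v (h1.symm.trans hx)), if_pos hx]
  have fo : ∀ x, Sum.inl x ≠ A → Sum.inl x ≠ B → Sum.inl x ≠ u → Sum.inl x ≠ v →
      f x = D.conn x := fun x h1 h2 h3 h4 => by
    simp only [f]
    rw [if_neg h1, if_neg h2, if_neg h3, if_neg h4]
  have hu := h.height_le
  have hv := h.lt_height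
  rw [height_le_iff h.le] at hu
  rw [← not_le, height_le_iff h.le] at hv
  have hAB : ∀ x, Sum.inl x = A → endPos A = 2 * n + 2 - j := by
    rintro x rfl
    exact h.above.endPos_eq
  have hBp := h.below.endPos_eq
  have hpos : ∀ x, Sum.inl x = A ∨ Sum.inl x = u → 0 < j := by
    have hx0 : ∀ x : Node n, 0 < height (X := X) (Sum.inl x) := by
      rintro (i | i) <;> simp [height]
    rintro x (rfl | rfl)
    · have := hx0 x
      have := h.height_A
      omega
    · have := hx0 x
      have := h.height_le
      omega
  -- up to the order of its ends, a string of the new diagram is an untouched old string or one of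
  -- the two new strings
  have hcase : ∀ x, ∃ p q, (∀ y z, (Crosses (nodePos x) (endPos (f x)) y z ↔ Crosses p q y z) ∧
        (Crosses y z (nodePos x) (endPos (f x)) ↔ Crosses y z p q)) ∧
      ((p = 2 * n + 2 - j ∧ q = endPos u ∧ 0 < j) ∨ (p = 2 * n + 1 - j ∧ q = endPos v) ∨
        (p = nodePos x ∧ q = endPos (D.conn x) ∧ Sum.inl x ≠ A ∧ Sum.inl x ≠ B)) := by
    intro x
    by_cases h1 : Sum.inl x = A
    · refine ⟨_, _, fun y z => ⟨Iff.rfl, Iff.rfl⟩, Or.inl ⟨?_, ?_, hpos x (Or.inl h1)⟩⟩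
      · rw [← hAB x h1, ← h1]; rfl
      · rw [fA x h1]
    by_cases h2 : Sum.inl x = B
    · refine ⟨_, _, fun y z => ⟨Iff.rfl, Iff.rfl⟩, Or.inr (Or.inl ⟨?_, ?_⟩)⟩
      · rw [← hBp, ← h2]; rfl
      · rw [fB x h2]
    by_cases h3 : Sum.inl x = u
    · refine ⟨_, _, fun y z => ⟨crosses_comm _ _ _ _, crosses_comm' _ _ _ _⟩,
        Or.inl ⟨?_, ?_, hpos x (Or.inr h3)⟩⟩
      · rw [fu x h3]
        rcases h.above with ⟨k, hk, hkA⟩ | ⟨h0, -⟩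
        · exact hAB _ hkA.symm
        · have := hpos x (Or.inr h3)
          omega
      · rw [← h3]; rfl
    by_cases h4 : Sum.inl x = v
    · refine ⟨_, _, fun y z => ⟨crosses_comm _ _ _ _, crosses_comm' _ _ _ _⟩,
        Or.inr (Or.inl ⟨?_, ?_⟩)⟩
      · rw [fv x h4, hBp]
      · rw [← h4]; rfl
    · refine ⟨_, _, fun y z => ⟨Iff.rfl, Iff.rfl⟩, Or.inr (Or.inr ⟨rfl, ?_, h1, h2⟩)⟩
      rw [fo x h1 h2 h3 h4]
  have hold : ∀ x, Sum.inl x ≠ A → Sum.inl x ≠ B →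
      (¬ Crosses (2 * n + 2 - j) (endPos u) (nodePos x) (endPos (D.conn x)) ∧
        ¬ Crosses (nodePos x) (endPos (D.conn x)) (2 * n + 2 - j) (endPos u)) ∧
      ¬ Crosses (2 * n + 1 - j) (endPos v) (nodePos x) (endPos (D.conn x)) ∧
        ¬ Crosses (nodePos x) (endPos (D.conn x)) (2 * n + 1 - j) (endPos v) := by
    intro x h1 h2
    have hx := isString_conn D x
    refine not_crosses_surgery h.le hu (endPos_le u) hv (nodePos_le x) (endPos_le _)
      (h.string.not_crosses hx) (hx.not_crosses h.string) ?_ ?_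
    · intro h3 h4
      refine h.closest _ _ hx ((height_le_iff h.le _).2 h3) ?_ fun h5 => h1 h5.1
      rwa [← not_le, height_le_iff h.le]
    · intro h3 h4
      refine h.closest _ _ hx.symm ((height_le_iff h.le _).2 h3) ?_ fun h5 => h2 h5.2
      rwa [← not_le, height_le_iff h.le]
  have hnew : 0 < j →
      ¬ Crosses (2 * n + 2 - j) (endPos u) (2 * n + 1 - j) (endPos v) ∧
      ¬ Crosses (2 * n + 1 - j) (endPos v) (2 * n + 2 - j) (endPos u) := by
    have := h.le
    have := endPos_le u
    rw [not_or, not_le, not_le] at hv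
    intro hj
    unfold Crosses
    omega
  refine ⟨⟨f, ?_, ?_, ?_⟩, fA, fB, fu, fv, fo⟩
  · intro x hx
    by_cases h1 : Sum.inl x = A
    · exact h.ne_u_of_eq_A h1 (hx.symm.trans (fA x h1))
    by_cases h2 : Sum.inl x = B
    · exact h.ne_v_of_eq_B h2 (hx.symm.trans (fB x h2))
    by_cases h3 : Sum.inl x = u
    · exact h1 (hx.symm.trans (fu x h3))
    by_cases h4 : Sum.inl x = v
    · exact h2 (hx.symm.trans (fv x h4))
    · exact D.conn_ne x ((fo x h1 h2 h3 h4).symm.trans hx)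
  · intro x w hx
    by_cases h1 : Sum.inl x = A
    · rw [fA x h1] at hx
      rw [fu w hx.symm, h1]
    by_cases h2 : Sum.inl x = B
    · rw [fB x h2] at hx
      rw [fv w hx.symm, h2]
    by_cases h3 : Sum.inl x = u
    · rw [fu x h3] at hx
      rw [fA w hx.symm, h3]
    by_cases h4 : Sum.inl x = v
    · rw [fv x h4] at hx
      rw [fB w hx.symm, h4]
    · rw [fo x h1 h2 h3 h4] at hx
      obtain ⟨h5, h6, h7, h8⟩ := h.conn_ne_of_ne h1 h2 h3 h4 hx
      rw [fo w h5 h6 h7 h8]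
      exact D.conn_symm _ _ hx
  · intro x y
    obtain ⟨p, q, hpq, hx⟩ := hcase x
    obtain ⟨r, s, hrs, hy⟩ := hcase y
    rw [(hpq _ _).1, (hrs _ _).2]
    rcases hx with ⟨rfl, rfl, hj⟩ | ⟨rfl, rfl⟩ | ⟨rfl, rfl, hx1, hx2⟩ <;>
      rcases hy with ⟨rfl, rfl, hj'⟩ | ⟨rfl, rfl⟩ | ⟨rfl, rfl, hy1, hy2⟩
    · exact not_crosses_self _ _
    · exact (hnew hj).1
    · exact (hold y hy1 hy2).1.1
    · exact (hnew hj').2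
    · exact not_crosses_self _ _
    · exact (hold y hy1 hy2).2.1
    · exact (hold x hx1 hx2).1.2
    · exact (hold x hx1 hx2).2.2
    · exact D.planar x y

end IsNextCrossing

/-! ### Factoring a generator off on the left -/

/-- The string of the concatenation of `D` and `E` that contains the node `p` has the end `s`. -/
def EndsAt (D E : Diagram n X) (p : CNode n) : Node n ⊕ (Bdry × X) → Prop
  | Sum.inl w => Joined D E p (outer w)
  | Sum.inr b => ∃ q, Joined D E p q ∧ piece D E q = Sum.inr b

theorem EndsAt.of_joined {D E : Diagram n X} {p q : CNode n} {s : Node n ⊕ (Bdry × X)}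
    (h : EndsAt D E q s) (hpq : Joined D E p q) : EndsAt D E p s := by
  rcases s with w | b
  · exact hpq.trans h
  · obtain ⟨r, hr, hb⟩ := h
    exact ⟨r, hpq.trans hr, hb⟩

theorem EndsAt.hasEnd {D E F : Diagram n X} {u : Node n} (h : EndsAt D E (outer u) (F.conn u)) :
    HasEnd D E u (F.conn u) := by
  rcases hc : F.conn u with w | b
  · rw [hc] at h
    exact ⟨fun hw => F.conn_ne u (hw ▸ hc), h⟩
  · rw [hc] at h
    exact h

/-- `G` links `A` to `B` on the left and `A'` to `B'` on the right, at the gap `j`, and all other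
strings go straight across.  The generators `e_i`, `f^top` and `f^bot` are of this form, with
`j = i`, `j = 0` and `j = n`. -/
structure IsCupCap (G : Diagram n X) (j : ℕ) (A B A' B' : Node n ⊕ (Bdry × X)) : Prop where
  above : IsAbove Sum.inl j A
  below : IsBelow Sum.inl j B
  above' : IsAbove Sum.inr j A'
  below' : IsBelow Sum.inr j B'
  cup : IsString G A B
  cap : IsString G A' B'
  through : ∀ k : Fin n, (k : ℕ) + 1 ≠ j → (k : ℕ) ≠ j →
    G.conn (Sum.inl k) = Sum.inl (Sum.inr k)

/-- A generator `G` with the same cup undoes the surgery: in the concatenation the right side of `G`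
joins the strings from `u` and from `v` again. -/
theorem IsNextCrossing.comp_eq {D G T : Diagram n X} {j : ℕ}
    {A B u v A' B' : Node n ⊕ (Bdry × X)}
    (h : IsNextCrossing D j A B u v) (hT : IsSurgery D T A B u v) (hG : IsCupCap G j A B A' B')
    (hu : j = 0 → u = A') (hv : j = n → v = B') : G.comp T = D ∧ ReachesOuter G T := by
  have hAk : ∀ k : Fin n, (k : ℕ) + 1 = j →
      A = Sum.inl (Sum.inl k) ∧ A' = Sum.inl (Sum.inr k) := by
    intro k hk
    constructor
    · rcases hG.above with ⟨l, hl, rfl⟩ | ⟨h0, -⟩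
      · rw [show l = k from Fin.ext (by omega)]
      · omega
    · rcases hG.above' with ⟨l, hl, rfl⟩ | ⟨h0, -⟩
      · rw [show l = k from Fin.ext (by omega)]
      · omega
  have hBk : ∀ k : Fin n, (k : ℕ) = j → B = Sum.inl (Sum.inl k) ∧ B' = Sum.inl (Sum.inr k) := by
    intro k hk
    have := k.2
    constructor
    · rcases hG.below with ⟨l, hl, rfl⟩ | ⟨h0, -⟩
      · rw [show l = k from Fin.ext (by omega)]
      · omega
    · rcases hG.below' with ⟨l, hl, rfl⟩ | ⟨h0, -⟩
      · rw [show l = k from Fin.ext (by omega)]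
      · omega
  have hthrough : ∀ x, Sum.inl x ≠ A → Sum.inl x ≠ B → Joined G T (outer x) (Sum.inr x) := by
    rintro (k | k) h1 h2
    · exact joined_through T (hG.through k (fun h3 => h1 (hAk k h3).1.symm)
        (fun h3 => h2 (hBk k h3).1.symm))
    · exact .refl _ _ _
  -- following a string of `T` that does not come back to the cup
  have hends : ∀ x s, T.conn x = s →
      (∀ w, s = Sum.inl w → Sum.inl w ≠ A ∧ Sum.inl w ≠ B) → EndsAt G T (Sum.inr x) s := by
    rintro x (w | b) h1 h2
    · exact (joined_inr G h1).trans (hthrough w (h2 w rfl).1 (h2 w rfl).2).symm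
    · exact ⟨_, .refl _ _ _, piece_inr_eq.2 h1⟩
  have hAu : ∀ k : Fin n, (k : ℕ) + 1 = j → EndsAt G T (Sum.inr (Sum.inl k)) u := fun k hk =>
    hends _ _ (hT.conn_A _ (hAk k hk).1.symm)
      (fun w hw => ⟨fun h1 => h.ne_u_of_eq_A h1 hw.symm, fun h1 => h.u_ne_B (hw.trans h1)⟩)
  have hBv : ∀ k : Fin n, (k : ℕ) = j → EndsAt G T (Sum.inr (Sum.inl k)) v := fun k hk =>
    hends _ _ (hT.conn_B _ (hBk k hk).1.symm)
      (fun w hw => ⟨fun h1 => h.A_ne_v (h1.symm.trans hw.symm),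
        fun h1 => h.ne_v_of_eq_B h1 hw.symm⟩)
  have hAv : ∀ k : Fin n, (k : ℕ) + 1 = j → EndsAt G T (Sum.inr (Sum.inl k)) v := by
    intro k hk
    have hcap := hG.cap
    rw [(hAk k hk).2] at hcap
    rcases hG.below' with ⟨l, hl, hB⟩ | ⟨h0, b, hB⟩
    · rw [hB] at hcap
      exact (hBv l hl).of_joined ((joined_mid G T k).symm.trans
        ((joined_inl T hcap.conn_eq).trans (joined_mid G T l)))
    · rw [hv h0, hB]
      rw [hB] at hcap
      exact ⟨_, (joined_mid G T k).symm, piece_inl_eq.2 hcap.conn_eq⟩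
  have hBu : ∀ k : Fin n, (k : ℕ) = j → EndsAt G T (Sum.inr (Sum.inl k)) u := by
    intro k hk
    have hcap := hG.cap.symm
    rw [(hBk k hk).2] at hcap
    rcases hG.above' with ⟨l, hl, hA⟩ | ⟨h0, b, hA⟩
    · rw [hA] at hcap
      exact (hAu l hl).of_joined ((joined_mid G T k).symm.trans
        ((joined_inl T hcap.conn_eq).trans (joined_mid G T l)))
    · rw [hu h0, hA]
      rw [hA] at hcap
      exact ⟨_, (joined_mid G T k).symm, piece_inl_eq.2 hcap.conn_eq⟩
  have hcup : ∀ x s, IsString G (Sum.inl (Sum.inl x)) s →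
      (∀ y, s = Sum.inl y → ∃ k, y = Sum.inl k) →
      EndsAt G T (outer (Sum.inl x)) s := by
    rintro x (w | b) h1 h2
    · obtain ⟨k, rfl⟩ := h2 w rfl
      exact joined_inl T h1.conn_eq
    · exact ⟨_, .refl _ _ _, piece_inl_eq.2 h1.conn_eq⟩
  have hnode : ∀ s, EndsAt G T (Sum.inr s) u → EndsAt G T (Sum.inr s) v →
      ∃ w, Joined G T (Sum.inr s) (outer w) := by
    intro s h1 h2
    rcases u with u | b
    · exact ⟨u, h1⟩
    · rcases v with v | c
      · exact ⟨v, h2⟩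
      · exact h.string.not_bdry.elim
  refine ⟨comp_eq_of_hasEnd fun x => EndsAt.hasEnd ?_, reachesOuter_of_mid fun m => ?_⟩
  · by_cases h1 : Sum.inl x = A
    · have hs := hG.cup
      rw [← h1] at hs
      have hD := h.cup
      rw [← h1] at hD
      rw [hD.conn_eq]
      rcases hG.above with ⟨k, hk, hkA⟩ | ⟨-, a, ha⟩
      · rw [hkA] at h1
        obtain rfl : x = Sum.inl k := by simpa using h1
        refine hcup _ _ hs fun y hy => ?_
        rcases hG.below with ⟨l, -, hl⟩ | ⟨-, b, hb⟩
        · rw [hl] at hy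
          exact ⟨l, by simpa using hy.symm⟩
        · rw [hb] at hy
          simp at hy
      · rw [ha] at h1
        simp at h1
    by_cases h2 : Sum.inl x = B
    · have hs := hG.cup.symm
      rw [← h2] at hs
      have hD := h.cup.symm
      rw [← h2] at hD
      rw [hD.conn_eq]
      rcases hG.below with ⟨k, hk, hkB⟩ | ⟨-, a, ha⟩
      · rw [hkB] at h2
        obtain rfl : x = Sum.inl k := by simpa using h2
        refine hcup _ _ hs fun y hy => ?_
        rcases hG.above with ⟨l, -, hl⟩ | ⟨-, b, hb⟩
        · rw [hl] at hy
          exact ⟨l, by simpa using hy.symm⟩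
        · rw [hb] at hy
          simp at hy
      · rw [ha] at h2
        simp at h2
    have hx := hthrough x h1 h2
    by_cases h3 : Sum.inl x = u
    · have hs := h.string
      rw [← h3] at hs
      rw [hs.conn_eq]
      have hc := hT.conn_u x h3
      rcases hG.above with ⟨k, hk, hkA⟩ | ⟨h0, -⟩
      · rw [hkA] at hc
        exact (hAv k hk).of_joined (hx.trans (joined_inr G hc))
      · have := h.height_le
        rw [← h3] at this
        rcases x with i | i <;> simp only [height] at this <;> omega
    by_cases h4 : Sum.inl x = v
    · have hs := h.string.symm
      rw [← h4] at hs
      rw [hs.conn_eq]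
      have hc := hT.conn_v x h4
      rcases hG.below with ⟨k, hk, hkB⟩ | ⟨h0, -⟩
      · rw [hkB] at hc
        exact (hBu k hk).of_joined (hx.trans (joined_inr G hc))
      · have := h.lt_height
        rw [← h4] at this
        rcases x with i | i <;> simp only [height] at this <;> omega
    · have ho := hT.conn_other x h1 h2 h3 h4
      refine (hends x _ ho fun w hw => ?_).of_joined hx
      obtain ⟨h5, h6, -, -⟩ := h.conn_ne_of_ne h1 h2 h3 h4 hw
      exact ⟨h5, h6⟩
  · by_cases h1 : (m : ℕ) + 1 = j
    · exact hnode _ (hAu m h1) (hAv m h1)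
    by_cases h2 : (m : ℕ) = j
    · exact hnode _ (hBu m h2) (hBv m h2)
    · exact ⟨Sum.inl m, (joined_through T (hG.through m h1 h2)).symm⟩

theorem isCupCap_e {i : ℕ} (hi : i + 1 < n) :
    IsCupCap (e i hi : Diagram n X) (i + 1) (Sum.inl (Sum.inl ⟨i, by omega⟩))
      (Sum.inl (Sum.inl ⟨i + 1, hi⟩)) (Sum.inl (Sum.inr ⟨i, by omega⟩))
      (Sum.inl (Sum.inr ⟨i + 1, hi⟩)) where
  above := Or.inl ⟨_, rfl, rfl⟩
  below := Or.inl ⟨_, rfl, rfl⟩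
  above' := Or.inl ⟨_, rfl, rfl⟩
  below' := Or.inl ⟨_, rfl, rfl⟩
  cup := Or.inl ⟨_, rfl, by simp [e]⟩
  cap := Or.inl ⟨_, rfl, by simp [e]⟩
  through k h1 h2 := by
    simp only [e]
    rw [if_neg (by omega), if_neg h2]

theorem isCupCap_fTop (hn : 0 < n) (a b : X) :
    IsCupCap (fTop a b : Diagram n X) 0 (Sum.inr (Bdry.top, a)) (Sum.inl (Sum.inl ⟨0, hn⟩))
      (Sum.inr (Bdry.top, b)) (Sum.inl (Sum.inr ⟨0, hn⟩)) where
  above := Or.inr ⟨rfl, _, rfl⟩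
  below := Or.inl ⟨_, rfl, rfl⟩
  above' := Or.inr ⟨rfl, _, rfl⟩
  below' := Or.inl ⟨_, rfl, rfl⟩
  cup := Or.inr ⟨_, rfl, by simp [fTop]⟩
  cap := Or.inr ⟨_, rfl, by simp [fTop]⟩
  through _ _ h := if_neg h

theorem isCupCap_fBot (hn : 0 < n) (a b : X) :
    IsCupCap (fBot a b : Diagram n X) n (Sum.inl (Sum.inl ⟨n - 1, Nat.sub_lt hn one_pos⟩))
      (Sum.inr (Bdry.bot, a)) (Sum.inl (Sum.inr ⟨n - 1, Nat.sub_lt hn one_pos⟩))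
      (Sum.inr (Bdry.bot, b)) where
  above := Or.inl ⟨_, Nat.sub_add_cancel hn, rfl⟩
  below := Or.inr ⟨rfl, _, rfl⟩
  above' := Or.inl ⟨_, Nat.sub_add_cancel hn, rfl⟩
  below' := Or.inr ⟨rfl, _, rfl⟩
  cup := Or.inl ⟨_, rfl, if_pos (Nat.sub_add_cancel hn)⟩
  cap := Or.inl ⟨_, rfl, if_pos (Nat.sub_add_cancel hn)⟩
  through _ h _ := if_neg h

theorem eq_top_of_height_le_zero {s : Node n ⊕ (Bdry × X)} (h : height s ≤ 0) :
    ∃ a, s = Sum.inr (Bdry.top, a) := by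
  rcases s with (i | i) | ⟨_ | _, a⟩ <;> simp [height] at h
  exact ⟨a, rfl⟩

theorem eq_bot_of_lt_height {s : Node n ⊕ (Bdry × X)} (h : n < height s) :
    ∃ a, s = Sum.inr (Bdry.bot, a) := by
  rcases s with (i | i) | ⟨_ | _, a⟩ <;> simp only [height] at h
  · omega
  · omega
  · omega
  · exact ⟨a, rfl⟩

/-- There is a generator with the given cup whose labels on the right are those of the next crossing
string, in case the gap is next to a boundary. -/
theorem IsNextCrossing.exists_isCupCap {D : Diagram n X} {j : ℕ}
    {A B u v : Node n ⊕ (Bdry × X)} (hn : 0 < n) (h : IsNextCrossing D j A B u v) :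
    ∃ G ∈ evenGenerators n X, ∃ A' B', IsCupCap G j A B A' B' ∧ (j = 0 → u = A') ∧
      (j = n → v = B') := by
  rcases h.above with ⟨k, hk, hA⟩ | ⟨rfl, a, hA⟩ <;> rcases h.below with ⟨l, hl, hB⟩ | ⟨rfl, c, hB⟩
  · have hl' := l.2
    have hkn : (k : ℕ) + 1 < n := by omega
    refine ⟨e k hkn, Or.inl ⟨_, _, rfl⟩, Sum.inl (Sum.inr ⟨k, by omega⟩),
      Sum.inl (Sum.inr ⟨k + 1, hkn⟩), ?_, by omega, by omega⟩
    obtain rfl : l = ⟨k + 1, hkn⟩ := Fin.ext (by simp only; omega)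
    subst hk
    rw [hA, hB]
    exact isCupCap_e hkn
  · obtain ⟨b, hb⟩ := eq_bot_of_lt_height h.lt_height
    refine ⟨fBot c b, Or.inr (Or.inr ⟨_, _, rfl⟩),
      Sum.inl (Sum.inr ⟨j - 1, Nat.sub_lt hn one_pos⟩), _, ?_, fun h0 => absurd h0 hn.ne',
      fun _ => hb⟩
    rw [hA, hB, show k = ⟨j - 1, Nat.sub_lt hn one_pos⟩ from Fin.ext (by simp only; omega)]
    exact isCupCap_fBot hn c b
  · obtain ⟨b, hb⟩ := eq_top_of_height_le_zero h.height_le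
    refine ⟨fTop a b, Or.inr (Or.inl ⟨_, _, rfl⟩), _,
      Sum.inl (Sum.inr ⟨0, hn⟩), ?_, fun _ => hb, fun h0 => absurd h0.symm hn.ne'⟩
    rw [hA, hB, show l = ⟨0, hn⟩ from Fin.ext hl]
    exact isCupCap_fTop hn a b
  · omega

/-! ### The number of crossings of strings with horizontal lines -/

/-- The contribution of a node with string ends `s` and `t` to the total number of crossings of
the strings with the horizontal lines; a string between two nodes is met twice, at both of its
ends, so that a string to a boundary has to be counted twice. -/
def crossings (s t : Node n ⊕ (Bdry × X)) : ℕ :=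
  (if t.isLeft then 1 else 2) * (height s - height t + (height t - height s))

/-- Twice the number of crossings of the strings of a diagram with the horizontal lines through
the gaps. -/
def totalCrossings (D : Diagram n X) : ℕ := ∑ v, crossings (Sum.inl v) (D.conn v)

/-- The two ends of a string together contribute twice its number of crossings; for an empty string
between two ends on the same boundary this is `0`. -/
theorem crossings_add_crossings {s t : Node n ⊕ (Bdry × X)}
    (h : s.isLeft ∨ t.isLeft ∨ height s = height t) :
    (if s.isLeft then crossings s t else 0) + (if t.isLeft then crossings t s else 0) =
      2 * (height s - height t + (height t - height s)) := by
  rcases s with s | b <;> rcases t with t | c <;> simp [crossings] at h ⊢ <;> omega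

theorem sum_lt_sum_of_eq_off {α : Type*} [Fintype α] [DecidableEq α] {f g : α → ℕ} (S : Finset α)
    (h : ∀ x ∉ S, f x = g x) (hS : ∑ x ∈ S, f x < ∑ x ∈ S, g x) : ∑ x, f x < ∑ x, g x := by
  rw [← Finset.sum_add_sum_compl S f, ← Finset.sum_add_sum_compl S g,
    Finset.sum_congr rfl fun x hx => h x (Finset.mem_compl.1 hx)]
  exact Nat.add_lt_add_right hS _

/-- The surgery removes the crossings of the line through the gap with the cup and with the string
from `u` to `v`, and leaves all other crossings. -/
theorem IsNextCrossing.totalCrossings_lt {D T : Diagram n X} {j : ℕ}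
    {A B u v : Node n ⊕ (Bdry × X)} (h : IsNextCrossing D j A B u v)
    (hT : IsSurgery D T A B u v) : totalCrossings T < totalCrossings D := by
  classical
  have hA := h.height_A
  have hB := h.height_B
  have hu := h.height_le
  have hv := h.lt_height
  have h1 := h.A_ne_B
  have h2 := h.A_ne_v
  have h3 := h.u_ne_B
  have h4 := h.u_ne_v
  have h5 := fun x => h.ne_u_of_eq_A (x := x)
  have h6 := fun x => h.ne_v_of_eq_B (x := x)
  have hAB := h.cup
  have huv := h.string
  obtain ⟨hTA, hTB, hTu, hTv, ho⟩ := hT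
  have hDA : ∀ x, Sum.inl x = A → D.conn x = B := by rintro x rfl; exact hAB.conn_eq
  have hDB : ∀ x, Sum.inl x = B → D.conn x = A := by rintro x rfl; exact hAB.symm.conn_eq
  have hDu : ∀ x, Sum.inl x = u → D.conn x = v := by rintro x rfl; exact huv.conn_eq
  have hDv : ∀ x, Sum.inl x = v → D.conn x = u := by rintro x rfl; exact huv.symm.conn_eq
  refine sum_lt_sum_of_eq_off (Finset.univ.filter fun x => Sum.inl x = A ∨ Sum.inl x = B ∨
    Sum.inl x = u ∨ Sum.inl x = v) ?_ ?_
  · intro x hx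
    simp only [Finset.mem_filter, Finset.mem_univ, true_and, not_or] at hx
    rw [ho x hx.1 hx.2.1 hx.2.2.1 hx.2.2.2]
  · have hsum : ∀ (s : Node n ⊕ (Bdry × X)) (F : Node n → ℕ),
        ∑ x with Sum.inl x = s, F x = Sum.elim F (fun _ => 0) s := by
      rintro (w | b) F
      · simp [Finset.sum_filter]
      · simp
    have key : ∀ F : Node n → ℕ, ∑ x with Sum.inl x = A ∨ Sum.inl x = B ∨ Sum.inl x = u ∨
        Sum.inl x = v, F x = Sum.elim F (fun _ => 0) A + (Sum.elim F (fun _ => 0) B +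
          (Sum.elim F (fun _ => 0) u + Sum.elim F (fun _ => 0) v)) := by
      intro F
      rw [Finset.filter_or, Finset.filter_or, Finset.filter_or, Finset.sum_union,
        Finset.sum_union, Finset.sum_union, hsum, hsum, hsum, hsum]
      · rw [Finset.disjoint_filter]
        exact fun x _ h7 h8 => h4 (h7.symm.trans h8)
      · rw [← Finset.filter_or, Finset.disjoint_filter]
        rintro x - h7 (h8 | h8)
        · exact h3 (h8.symm.trans h7)
        · exact h6 x h7 h8
      · rw [← Finset.filter_or, ← Finset.filter_or, Finset.disjoint_filter]
        rintro x - h7 (h8 | h8 | h8)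
        · exact h1 (h7.symm.trans h8)
        · exact h5 x h7 h8
        · exact h2 (h7.symm.trans h8)
    rw [key, key]
    -- contributions of the four ends before and after the surgery
    have hh : ∀ (T : Diagram n X) (s t : Node n ⊕ (Bdry × X)),
        (∀ x, Sum.inl x = s → T.conn x = t) →
        Sum.elim (fun x => crossings (Sum.inl x) (T.conn x)) (fun _ => 0) s =
          if s.isLeft then crossings s t else 0 := by
      rintro T (w | b) t h7
      · simp [h7 w rfl]
      · simp
    rw [hh T A u hTA, hh T B v hTB, hh T u A hTu, hh T v B hTv, hh D A B hDA, hh D B A hDB,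
      hh D u v hDu, hh D v u hDv]
    have hnode : ∀ s t, IsString D s t → s.isLeft ∨ t.isLeft ∨ height s = height t := by
      rintro (w | b) (w' | c) h
      · simp
      · simp
      · simp
      · exact h.not_bdry.elim
    have hjA : A.isLeft ∨ u.isLeft ∨ height A = height u := by
      rcases h.above with ⟨k, hk, rfl⟩ | ⟨h0, a, rfl⟩
      · simp
      · exact Or.inr (Or.inr (by omega))
    have hjB : B.isLeft ∨ v.isLeft ∨ height B = height v := by
      rcases h.below with ⟨k, hk, rfl⟩ | ⟨h0, a, rfl⟩
      · simp
      · have : height v ≤ n + 1 := by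
          rcases v with (i | i) | ⟨_ | _, x⟩ <;> simp only [height] <;> omega
        exact Or.inr (Or.inr (by omega))
    have e1 := crossings_add_crossings (hnode _ _ hAB)
    have e2 := crossings_add_crossings (hnode _ _ huv)
    have e3 := crossings_add_crossings hjA
    have e4 := crossings_add_crossings hjB
    omega

/-! ### Even diagrams -/

/-- A diagram is even if its left and right nodes in the same row are always linked to the same
boundary. -/
theorem isEven_of_left_right {D : Diagram n X}
    (h : ∀ s k, (∃ x, D.conn (Sum.inl k) = Sum.inr (s, x)) ↔
      ∃ x, D.conn (Sum.inr k) = Sum.inr (s, x)) : IsEven D := by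
  classical
  constructor <;>
  · rw [numBdryLinks_eq_card]
    refine even_card_of_conn_mem (one : Diagram n X) _ ?_
    rintro (k | k) hk <;> simp only [Finset.mem_filter, Finset.mem_univ, true_and] at hk ⊢
    · exact ⟨_, (h _ k).1 hk, rfl⟩
    · exact ⟨_, (h _ k).2 hk, rfl⟩

theorem isEven_of_mem_evenGenerators {G : Diagram n X} (hG : G ∈ evenGenerators n X) :
    IsEven G := by
  rcases hG with ⟨i, hi, rfl⟩ | ⟨a, b, rfl⟩ | ⟨a, b, rfl⟩ <;> refine isEven_of_left_right ?_
  · intro s k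
    simp only [e]
    split_ifs <;> simp
  · intro s k
    simp only [fTop]
    split_ifs <;> simp
  · intro s k
    simp only [fBot]
    split_ifs <;> simp

/-- A generator is factored off at a cup on the left side, and the remaining diagram has fewer
crossings with the horizontal lines. -/
theorem isCleanProduct_of_isEven (hn : 0 < n) (D : Diagram n X) (hD : IsEven D) :
    IsCleanProduct (evenGenerators n X) D := by
  induction hc : totalCrossings D using Nat.strong_induction_on generalizing D with
  | _ c ih =>
    by_cases h1 : D = one
    · rw [h1]
      exact .one
    · obtain ⟨j, A, B, hj, hA, hB, hAB⟩ := exists_cup D h1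
      obtain ⟨u, v, h⟩ := exists_isNextCrossing hD hj hA hB hAB
      obtain ⟨T, hT⟩ := h.exists_isSurgery
      obtain ⟨G, hGm, A', B', hG, hu, hv⟩ := h.exists_isCupCap hn
      obtain ⟨hGT, hreach⟩ := h.comp_eq hT hG hu hv
      have hGe := isEven_of_mem_evenGenerators hGm
      have hTe : IsEven T := by
        obtain ⟨h2, h3⟩ := hD
        rw [← hGT, hreach.numBdryLinks_comp, Nat.even_add] at h2 h3
        exact ⟨h2.1 hGe.1, h3.1 hGe.2⟩
      rw [← hGT]
      exact .comp _ _ (.of _ hGm) (ih _ (hc ▸ h.totalCrossings_lt hT) T hTe rfl) hreach.clean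

/-! ### The diagrams `W(j)` -/

/-- The shape of the diagram `W(j)` with labels `a` and `b`: on the left there is a cup at the gap
`j` (a string to the top boundary if `j = 0`, to the bottom boundary if `j = n`), the left nodes
above the cup go one row down and those below it go one row up; the first node on the right is
linked to the top boundary unless `j = 0`, and the last one to the bottom boundary unless
`j = n`. -/
structure IsShift (G : Diagram n X) (j : ℕ) (a b : X) : Prop where
  upper : ∀ k m : Fin n, (k : ℕ) + 1 < j → (m : ℕ) = k + 1 →
    G.conn (Sum.inl k) = Sum.inl (Sum.inr m)
  lower : ∀ k m : Fin n, j < (k : ℕ) → (m : ℕ) + 1 = k →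
    G.conn (Sum.inl k) = Sum.inl (Sum.inr m)
  cup : ∀ k l : Fin n, (k : ℕ) + 1 = j → (l : ℕ) = j → G.conn (Sum.inl k) = Sum.inl (Sum.inl l)
  left_top : j = 0 → ∀ k : Fin n, (k : ℕ) = 0 → G.conn (Sum.inl k) = Sum.inr (Bdry.top, a)
  left_bot : j = n → ∀ k : Fin n, (k : ℕ) + 1 = n → G.conn (Sum.inl k) = Sum.inr (Bdry.bot, b)
  right_top : 0 < j → ∀ m : Fin n, (m : ℕ) = 0 → G.conn (Sum.inr m) = Sum.inr (Bdry.top, a)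
  right_bot : j < n → ∀ m : Fin n, (m : ℕ) + 1 = n → G.conn (Sum.inr m) = Sum.inr (Bdry.bot, b)

theorem isShift_wTop (hn : 0 < n) (a b : X) : IsShift (wTop a b : Diagram n X) 0 a b where
  upper k m h := by omega
  lower k m h1 h2 := by
    simp only [wTop]
    rw [if_neg (by omega)]
    simp only [Sum.inl.injEq, Sum.inr.injEq, Fin.ext_iff]
    omega
  cup k l h := by omega
  left_top _ k hk := if_pos hk
  left_bot h := by omega
  right_top h := by omega
  right_bot _ m hm := dif_pos hm

theorem isShift_wBot (hn : 0 < n) (a b : X) : IsShift (wBot a b : Diagram n X) n a b where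
  upper k m h1 h2 := by
    simp only [wBot]
    rw [dif_neg (by omega)]
    simp only [Sum.inl.injEq, Sum.inr.injEq, Fin.ext_iff]
    omega
  lower k m h1 h2 := by omega
  cup k l _ h := by omega
  left_top h := by omega
  left_bot _ k hk := dif_pos hk
  right_top _ m hm := if_pos hm
  right_bot h := by omega

theorem e_conn_inl {i : ℕ} (hi : i + 1 < n) {k : Fin n} (h1 : (k : ℕ) ≠ i)
    (h2 : (k : ℕ) ≠ i + 1) :
    (e i hi : Diagram n X).conn (Sum.inl k) = Sum.inl (Sum.inr k) := by
  simp only [e]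
  rw [if_neg h1, if_neg h2]

theorem e_conn_cup {i : ℕ} (hi : i + 1 < n) {k l : Fin n} (h1 : (k : ℕ) = i)
    (h2 : (l : ℕ) = i + 1) :
    (e i hi : Diagram n X).conn (Sum.inl k) = Sum.inl (Sum.inl l) := by
  simp only [e]
  rw [if_pos h1]
  simp only [Sum.inl.injEq, Fin.ext_iff, h2]

theorem e_conn_cap {i : ℕ} (hi : i + 1 < n) {k l : Fin n} (h1 : (k : ℕ) = i)
    (h2 : (l : ℕ) = i + 1) :
    (e i hi : Diagram n X).conn (Sum.inr k) = Sum.inl (Sum.inr l) := by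
  simp only [e]
  rw [if_pos h1]
  simp only [Sum.inl.injEq, Sum.inr.injEq, Fin.ext_iff, h2]

/-- The cap of `e` links the left nodes in its two rows of the diagram to its right. -/
theorem joined_cap {i : ℕ} (hi : i + 1 < n) (G : Diagram n X) {k l : Fin n} (h1 : (k : ℕ) = i)
    (h2 : (l : ℕ) = i + 1) : Joined (e i hi) G (Sum.inr (Sum.inl k)) (Sum.inr (Sum.inl l)) :=
  (joined_mid _ _ k).symm.trans ((joined_inl G (e_conn_cap hi h1 h2)).trans (joined_mid _ _ l))

theorem conn_comp_of_joined {D E : Diagram n X} {u w : Node n} (hne : w ≠ u)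
    (h : Joined D E (outer u) (outer w)) : (D.comp E).conn u = Sum.inl w :=
  (hasEnd_iff D E u _).1 ⟨hne, h⟩

theorem conn_comp_of_bdry {D E : Diagram n X} {u v : Node n} {b : Bdry × X}
    (h : Joined D E (outer u) (Sum.inr v)) (hv : E.conn v = Sum.inr b) :
    (D.comp E).conn u = Sum.inr b :=
  (hasEnd_iff D E u _).1 ⟨_, h, piece_inr_eq.2 hv⟩

theorem IsShift.e_comp {G : Diagram n X} {j : ℕ} {a b : X} (hG : IsShift G j a b)
    (hj : j + 1 < n) : IsShift ((e j hj).comp G) (j + 1) a b where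
  upper k m h1 h2 := by
    have hk := joined_through G (e_conn_inl hj (k := k) (by omega) (by omega))
    refine conn_comp_of_joined (by simp) (hk.trans ?_)
    by_cases h3 : (k : ℕ) + 1 < j
    · exact joined_inr _ (hG.upper k m h3 h2)
    · have hjn : j < n := by omega
      exact (joined_inr _ (hG.cup k ⟨j, hjn⟩ (by omega) rfl)).trans
        ((joined_cap hj G (l := ⟨j + 1, hj⟩) rfl rfl).trans
          (joined_inr _ (hG.lower _ m (Nat.lt_succ_self j) (by simp only; omega))))
  lower k m h1 h2 := by
    have hk := joined_through G (e_conn_inl hj (k := k) (by omega) (by omega))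
    exact conn_comp_of_joined (by simp) (hk.trans (joined_inr _ (hG.lower k m (by omega) h2)))
  cup k l h1 h2 := by
    refine conn_comp_of_joined ?_ (joined_inl _ (e_conn_cup hj (by omega) h2))
    rw [Ne, Sum.inl.injEq, Fin.ext_iff]
    omega
  left_top h := by omega
  left_bot h := by omega
  right_top _ m hm := by
    rcases Nat.eq_zero_or_pos j with rfl | h0
    · have h1 : (⟨0, by omega⟩ : Fin n) = m := Fin.ext hm.symm
      refine conn_comp_of_bdry ?_ (hG.left_top rfl ⟨0, by omega⟩ rfl)
      exact (joined_inr _ (hG.lower ⟨1, hj⟩ m Nat.one_pos (by simp only; omega))).symm.trans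
        (joined_cap hj G (l := ⟨1, hj⟩) rfl rfl).symm
    · exact conn_comp_of_bdry (.refl _ _ _) (hG.right_top h0 m hm)
  right_bot h m hm := conn_comp_of_bdry (.refl _ _ _) (hG.right_bot (by omega) m hm)

theorem IsShift.reachesOuter_e {G : Diagram n X} {j : ℕ} {a b : X} (hG : IsShift G j a b)
    (hj : j + 1 < n) : ReachesOuter (e j hj) G := by
  have hl : ∀ l : Fin n, (l : ℕ) = j + 1 →
      Joined (e j hj) G (Sum.inr (Sum.inl l)) (outer (Sum.inr ⟨j, by omega⟩)) := fun l h =>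
    joined_inr _ (hG.lower l ⟨j, by omega⟩ (by omega) (by simp only; omega))
  refine reachesOuter_of_mid fun m => ?_
  by_cases h1 : (m : ℕ) = j
  · exact ⟨_, (joined_cap hj G h1 rfl).trans (hl ⟨j + 1, hj⟩ rfl)⟩
  by_cases h2 : (m : ℕ) = j + 1
  · exact ⟨_, hl m h2⟩
  · exact ⟨Sum.inl m, (joined_through G (e_conn_inl hj h1 h2)).symm⟩

theorem isShift_W (hn : 0 < n) (a b : X) (j : ℕ) (hj : j ≤ n) :
    IsShift (W a b j : Diagram n X) j a b := by
  induction j with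
  | zero => exact isShift_wTop hn a b
  | succ j ih =>
    rw [W]
    split_ifs with h
    · exact (ih (by omega)).e_comp h
    · obtain rfl : n = j + 1 := by omega
      exact isShift_wBot hn a b

theorem isOdd_of_conn {D : Diagram n X} (v w : Node n)
    (hv : ∀ x, (∃ a, D.conn x = Sum.inr (Bdry.top, a)) ↔ x = v)
    (hw : ∀ x, (∃ a, D.conn x = Sum.inr (Bdry.bot, a)) ↔ x = w) : IsOdd D := by
  classical
  constructor <;> rw [numBdryLinks_eq_card]
  · rw [Finset.card_eq_one.2 ⟨v, by ext x; simp [hv]⟩]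
    exact odd_one
  · rw [Finset.card_eq_one.2 ⟨w, by ext x; simp [hw]⟩]
    exact odd_one

theorem isOdd_wTop (hn : 0 < n) (a b : X) : IsOdd (wTop a b : Diagram n X) := by
  refine isOdd_of_conn (Sum.inl ⟨0, hn⟩) (Sum.inr ⟨n - 1, by omega⟩) ?_ ?_
  · rintro (k | k) <;> simp only [wTop] <;> split_ifs <;> simp [Fin.ext_iff, *]
  · rintro (k | k) <;> simp only [wTop] <;> split_ifs <;> simp [Fin.ext_iff] <;> omega

theorem isOdd_wBot (hn : 0 < n) (a b : X) : IsOdd (wBot a b : Diagram n X) := by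
  refine isOdd_of_conn (Sum.inr ⟨0, hn⟩) (Sum.inl ⟨n - 1, by omega⟩) ?_ ?_
  · rintro (k | k) <;> simp only [wBot] <;> split_ifs <;> simp [Fin.ext_iff, *]
  · rintro (k | k) <;> simp only [wBot] <;> split_ifs <;> simp [Fin.ext_iff] <;> omega

theorem isOdd_W (hn : 0 < n) (a b : X) (j : ℕ) (hj : j ≤ n) : IsOdd (W a b j : Diagram n X) := by
  induction j with
  | zero => exact isOdd_wTop hn a b
  | succ j ih =>
    rw [W]
    split_ifs with h
    · have hr := (isShift_W hn a b j (by omega)).reachesOuter_e h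
      have he : IsEven (e j h : Diagram n X) :=
        isEven_of_mem_evenGenerators (Or.inl ⟨j, h, rfl⟩)
      have ho := ih (by omega)
      constructor <;> rw [hr.numBdryLinks_comp]
      · exact he.1.add_odd ho.1
      · exact he.2.add_odd ho.2
    · exact isOdd_wBot hn a b

/-! ### Factoring `W(j)` off on the left -/

/-- The node of `T` at which a string of `W(j) T` that starts at the node `x` enters `T`, when `x`
is not one of the nodes of the cup of `W(j)`; the value there is meaningless. -/
def shiftNode (j : ℕ) : Node n → Node n
  | Sum.inl k => Sum.inl ⟨if (k : ℕ) + 1 < j ∧ (k : ℕ) + 1 < n then k + 1 else k - 1, by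
      split_ifs <;> omega⟩
  | Sum.inr k => Sum.inr k

/-- The inverse of `shiftNode`, with a meaningless value at those left nodes of `T` that are glued
to the strings of `W(j)` which join its right side to a boundary. -/
def unshiftNode (j : ℕ) : Node n → Node n
  | Sum.inl m => Sum.inl ⟨if j ≤ (m : ℕ) ∧ (m : ℕ) + 1 < n then m + 1 else m - 1, by
      split_ifs <;> omega⟩
  | Sum.inr m => Sum.inr m

/-- `x` is a node of the cup of `W(j)`. -/
def IsCupNode (j : ℕ) (x : Node n) : Prop :=
  ∃ k : Fin n, x = Sum.inl k ∧ ((k : ℕ) + 1 = j ∨ (k : ℕ) = j)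

/-- `y` is the left node in the first row, and it is glued to the string of `W(j)` from its right
side to the top boundary. -/
def IsTopNode (j : ℕ) (y : Node n) : Prop := 0 < j ∧ ∃ m : Fin n, y = Sum.inl m ∧ (m : ℕ) = 0

/-- `y` is the left node in the last row, and it is glued to the string of `W(j)` from its right
side to the bottom boundary. -/
def IsBotNode (j : ℕ) (y : Node n) : Prop := j < n ∧ ∃ m : Fin n, y = Sum.inl m ∧ (m : ℕ) + 1 = n

theorem unshift_shift {j : ℕ} (hj : j ≤ n) {x : Node n} (hx : ¬ IsCupNode j x) :
    unshiftNode j (shiftNode j x) = x ∧ ¬ IsTopNode j (shiftNode j x) ∧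
      ¬ IsBotNode j (shiftNode j x) := by
  rcases x with k | k
  · have h1 : (k : ℕ) + 1 ≠ j ∧ (k : ℕ) ≠ j := by
      constructor <;> intro h <;> exact hx ⟨k, rfl, by omega⟩
    have hk := k.2
    refine ⟨?_, ?_, ?_⟩
    · simp only [shiftNode, unshiftNode, Sum.inl.injEq, Fin.ext_iff]
      split_ifs <;> omega
    · rintro ⟨h2, m, hm, h3⟩
      simp only [shiftNode, Sum.inl.injEq, Fin.ext_iff] at hm
      split_ifs at hm <;> omega
    · rintro ⟨h2, m, hm, h3⟩
      simp only [shiftNode, Sum.inl.injEq, Fin.ext_iff] at hm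
      split_ifs at hm <;> omega
  · refine ⟨rfl, ?_, ?_⟩ <;> rintro ⟨-, m, hm, -⟩ <;> simp [shiftNode] at hm

theorem shift_unshift {j : ℕ} (hj : j ≤ n) {y : Node n} (h1 : ¬ IsTopNode j y)
    (h2 : ¬ IsBotNode j y) :
    shiftNode j (unshiftNode j y) = y ∧ ¬ IsCupNode j (unshiftNode j y) := by
  rcases y with m | m
  · have hm := m.2
    have h3 : ¬ (0 < j ∧ (m : ℕ) = 0) := fun h => h1 ⟨h.1, m, rfl, h.2⟩
    have h4 : ¬ (j < n ∧ (m : ℕ) + 1 = n) := fun h => h2 ⟨h.1, m, rfl, h.2⟩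
    refine ⟨?_, ?_⟩
    · simp only [shiftNode, unshiftNode, Sum.inl.injEq, Fin.ext_iff]
      split_ifs <;> omega
    · rintro ⟨k, hk, h⟩
      simp only [unshiftNode, Sum.inl.injEq, Fin.ext_iff] at hk
      split_ifs at hk <;> omega
  · refine ⟨rfl, ?_⟩
    rintro ⟨k, hk, -⟩
    simp [unshiftNode] at hk

/-- A string of the concatenation that starts at a node away from the cup of `W(j)` enters the
second diagram at the shifted node. -/
theorem IsShift.joined_shiftNode {G : Diagram n X} {j : ℕ} {a b : X} (hG : IsShift G j a b)
    (hj : j ≤ n) (T : Diagram n X) {x : Node n} (hx : ¬ IsCupNode j x) :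
    Joined G T (outer x) (Sum.inr (shiftNode j x)) := by
  rcases x with k | k
  · have h1 : (k : ℕ) + 1 ≠ j ∧ (k : ℕ) ≠ j := by
      constructor <;> intro h <;> exact hx ⟨k, rfl, by omega⟩
    have hk := k.2
    refine joined_through T ?_
    by_cases h : (k : ℕ) + 1 < j
    · exact hG.upper _ _ h (if_pos ⟨h, by omega⟩)
    · refine hG.lower _ _ (by omega) ?_
      have h2 : ¬ ((k : ℕ) + 1 < j ∧ (k : ℕ) + 1 < n) := fun h2 => h h2.1
      simp only [if_neg h2]
      omega
  · exact .refl _ _ _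

/-- The diagram `D` has the same cup on the left side as `W(j)`, the node `u` is the first node
linked to the top boundary if `j ≠ 0`, and the node `v` is the first node linked to the bottom
boundary if `j ≠ n`.  The order of the nodes is the one along the perimeter from the left end of the
respective boundary across the left side and then the right side. -/
structure IsLeftFactor (D : Diagram n X) (j : ℕ) (a b : X) (u v : Node n) : Prop where
  le : j ≤ n
  cup : ∀ k l : Fin n, (k : ℕ) + 1 = j → (l : ℕ) = j → D.conn (Sum.inl k) = Sum.inl (Sum.inl l)
  left_top : j = 0 → ∀ k : Fin n, (k : ℕ) = 0 → D.conn (Sum.inl k) = Sum.inr (Bdry.top, a)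
  left_bot : j = n → ∀ k : Fin n, (k : ℕ) + 1 = n → D.conn (Sum.inl k) = Sum.inr (Bdry.bot, b)
  conn_u : 0 < j → D.conn u = Sum.inr (Bdry.top, a)
  conn_v : j < n → D.conn v = Sum.inr (Bdry.bot, b)
  first_u : 0 < j → ∀ x c, D.conn x = Sum.inr (Bdry.top, c) → nodePos x ≤ nodePos u
  first_v : j < n → ∀ x c, D.conn x = Sum.inr (Bdry.bot, c) →
    (nodePos v ≤ n → nodePos x ≤ n ∧ nodePos v ≤ nodePos x) ∧
      (nodePos x ≤ n ∨ nodePos v ≤ nodePos x)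

/-- The diagram `T` arises from `D` by removing the cup on the left side, shifting the other left
nodes as in `W(j)`, and linking `u` and `v` to the first and the last node on the left instead of
to the top and the bottom boundary; the former is left out if `j = 0`, the latter if `j = n`. -/
structure IsLeftQuotient (D T : Diagram n X) (j : ℕ) (u v : Node n) : Prop where
  top : ∀ y, IsTopNode j y → T.conn y = Sum.inl (shiftNode j u)
  bot : ∀ y, IsBotNode j y → T.conn y = Sum.inl (shiftNode j v)
  other : ∀ x, ¬ IsCupNode j x → (0 < j → x ≠ u) → (j < n → x ≠ v) →
    T.conn (shiftNode j x) = Sum.map (shiftNode j) id (D.conn x)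

namespace IsLeftFactor

variable {D : Diagram n X} {j : ℕ} {a b : X} {u v : Node n}

theorem conn_cupNode (h : IsLeftFactor D j a b u v) {k : Fin n}
    (hk : IsCupNode j (Sum.inl k)) :
    (∃ l, D.conn (Sum.inl k) = Sum.inl (Sum.inl l) ∧ IsCupNode j (Sum.inl l) ∧
      ((k : ℕ) + 1 = j ∧ (l : ℕ) = j ∨ (l : ℕ) + 1 = j ∧ (k : ℕ) = j)) ∨
    (j = 0 ∧ (k : ℕ) = 0 ∧ D.conn (Sum.inl k) = Sum.inr (Bdry.top, a)) ∨
    (j = n ∧ (k : ℕ) + 1 = n ∧ D.conn (Sum.inl k) = Sum.inr (Bdry.bot, b)) := by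
  have hj := h.le
  have hkn := k.2
  obtain ⟨k', hk', hk⟩ := hk
  obtain rfl : k = k' := by simpa using hk'
  rcases hk with hk | hk
  · rcases hj.lt_or_eq with hj' | hj'
    · exact Or.inl ⟨⟨j, hj'⟩, h.cup _ _ hk rfl, ⟨_, rfl, Or.inr rfl⟩, Or.inl ⟨hk, rfl⟩⟩
    · exact Or.inr (Or.inr ⟨hj', by omega, h.left_bot hj' _ (by omega)⟩)
  · rcases Nat.eq_zero_or_pos j with hj' | hj'
    · exact Or.inr (Or.inl ⟨hj', by omega, h.left_top hj' _ (by omega)⟩)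
    · have h1 : j - 1 + 1 = j := by omega
      exact Or.inl ⟨⟨j - 1, by omega⟩, D.conn_symm _ _ (h.cup _ _ h1 hk),
        ⟨_, rfl, Or.inl h1⟩, Or.inr ⟨h1, hk⟩⟩

theorem not_isCupNode_u (h : IsLeftFactor D j a b u v) (hj : 0 < j) : ¬ IsCupNode j u := by
  intro hu
  obtain ⟨k, rfl, -⟩ := id hu
  have h1 := h.conn_u hj
  rcases h.conn_cupNode hu with ⟨l, h2, -⟩ | ⟨h2, -⟩ | ⟨-, -, h2⟩
  · rw [h1] at h2; simp at h2
  · omega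
  · rw [h1] at h2; simp at h2

theorem not_isCupNode_v (h : IsLeftFactor D j a b u v) (hj : j < n) : ¬ IsCupNode j v := by
  intro hv
  obtain ⟨k, rfl, -⟩ := id hv
  have h1 := h.conn_v hj
  rcases h.conn_cupNode hv with ⟨l, h2, -⟩ | ⟨-, -, h2⟩ | ⟨h2, -⟩
  · rw [h1] at h2; simp at h2
  · rw [h1] at h2; simp at h2
  · omega

theorem not_isCupNode_of_conn (h : IsLeftFactor D j a b u v) {x w : Node n}
    (hx : ¬ IsCupNode j x) (hw : D.conn x = Sum.inl w) : ¬ IsCupNode j w := by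
  intro hc
  obtain ⟨k, rfl, -⟩ := id hc
  have h1 := D.conn_symm _ _ hw
  rcases h.conn_cupNode hc with ⟨l, h2, h3, -⟩ | ⟨-, -, h2⟩ | ⟨-, -, h2⟩ <;> rw [h1] at h2
  · exact hx (by simpa using (Sum.inl.inj h2) ▸ h3)
  · simp at h2
  · simp at h2

theorem u_ne_v (h : IsLeftFactor D j a b u v) (h0 : 0 < j) (hn : j < n) : u ≠ v := by
  rintro rfl
  have := (h.conn_u h0).symm.trans (h.conn_v hn)
  simp at this

/-- Gluing `W(j)` to the left quotient gives the original diagram. -/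
theorem comp_eq {G T : Diagram n X} (h : IsLeftFactor D j a b u v) (hG : IsShift G j a b)
    (hT : IsLeftQuotient D T j u v) : G.comp T = D ∧ ReachesOuter G T := by
  have hs := fun x => hG.joined_shiftNode h.le T (x := x)
  have htop : ∀ y, IsTopNode j y → Joined G T (outer u) (Sum.inr y) := fun y hy =>
    (hs u (h.not_isCupNode_u hy.1)).trans (joined_inr G (hT.top y hy)).symm
  have hbot : ∀ y, IsBotNode j y → Joined G T (outer v) (Sum.inr y) := fun y hy =>
    (hs v (h.not_isCupNode_v hy.1)).trans (joined_inr G (hT.bot y hy)).symm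
  have hjn := h.le
  refine ⟨comp_eq_of_hasEnd fun x => EndsAt.hasEnd ?_, reachesOuter_of_mid fun m => ?_⟩
  · by_cases hx : IsCupNode j x
    · obtain ⟨k, rfl, -⟩ := id hx
      rcases h.conn_cupNode hx with
        ⟨l, h2, -, ⟨h3, h4⟩ | ⟨h3, h4⟩⟩ | ⟨h3, h4, h2⟩ | ⟨h3, h4, h2⟩ <;>
        rw [h2]
      · exact joined_inl T (hG.cup _ _ h3 h4)
      · exact (joined_inl T (hG.cup _ _ h3 h4)).symm
      · exact ⟨_, .refl _ _ _, piece_inl_eq.2 (hG.left_top h3 _ h4)⟩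
      · exact ⟨_, .refl _ _ _, piece_inl_eq.2 (hG.left_bot h3 _ h4)⟩
    by_cases h1 : 0 < j ∧ x = u
    · obtain ⟨h0, rfl⟩ := h1
      obtain ⟨m, hm⟩ : ∃ m : Fin n, (m : ℕ) = 0 := ⟨⟨0, by omega⟩, rfl⟩
      rw [h.conn_u h0]
      exact ⟨_, (htop _ ⟨h0, m, rfl, hm⟩).trans (joined_mid G T m).symm,
        piece_inl_eq.2 (hG.right_top h0 m hm)⟩
    by_cases h2 : j < n ∧ x = v
    · obtain ⟨h0, rfl⟩ := h2
      obtain ⟨m, hm⟩ : ∃ m : Fin n, (m : ℕ) + 1 = n :=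
        ⟨⟨n - 1, by omega⟩, by simp only; omega⟩
      rw [h.conn_v h0]
      exact ⟨_, (hbot _ ⟨h0, m, rfl, hm⟩).trans (joined_mid G T m).symm,
        piece_inl_eq.2 (hG.right_bot h0 m hm)⟩
    · have hc := hT.other x hx (fun h3 h4 => h1 ⟨h3, h4⟩) (fun h3 h4 => h2 ⟨h3, h4⟩)
      rcases hw : D.conn x with w | c <;> rw [hw] at hc
      · exact (hs x hx).trans ((joined_inr G hc).trans
          (hs w (h.not_isCupNode_of_conn hx hw)).symm)
      · exact ⟨_, hs x hx, piece_inr_eq.2 hc⟩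
  · by_cases h1 : IsTopNode j (Sum.inl m)
    · exact ⟨u, (htop _ h1).symm⟩
    by_cases h2 : IsBotNode j (Sum.inl m)
    · exact ⟨v, (hbot _ h2).symm⟩
    · obtain ⟨h3, h4⟩ := shift_unshift hjn h1 h2
      refine ⟨unshiftNode j (Sum.inl m), ?_⟩
      have := (hs _ h4).symm
      rwa [h3] at this

end IsLeftFactor

/-- The position of a string end after the shift of the left nodes. -/
def shiftPos (n j p : ℕ) : ℕ := if p ≤ n + 1 then p else if p + j ≤ 2 * n then p + 1 else p - 1

theorem nodePos_eq_of_isTopNode {j : ℕ} {y : Node n} (h : IsTopNode j y) :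
    nodePos y = 2 * n + 1 := by
  obtain ⟨-, m, rfl, hm⟩ := h
  simp only [nodePos]; omega

theorem nodePos_eq_of_isBotNode {j : ℕ} {y : Node n} (h : IsBotNode j y) :
    nodePos y = n + 2 := by
  obtain ⟨-, m, rfl, hm⟩ := h
  simp only [nodePos]; omega

theorem nodePos_injective : Function.Injective (nodePos (n := n)) := by
  rintro (k | k) (l | l) h <;> simp only [nodePos] at h <;>
    simp only [Sum.inl.injEq, Sum.inr.injEq, reduceCtorEq, Fin.ext_iff] <;> omega

theorem nodePos_ne (x : Node n) : nodePos x ≠ n + 1 := by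
  rcases x with k | k <;> simp only [nodePos] <;> omega

theorem IsTopNode.unique {j : ℕ} {y z : Node n} (hy : IsTopNode j y) (hz : IsTopNode j z) :
    y = z :=
  nodePos_injective (by rw [nodePos_eq_of_isTopNode hy, nodePos_eq_of_isTopNode hz])

theorem IsBotNode.unique {j : ℕ} {y z : Node n} (hy : IsBotNode j y) (hz : IsBotNode j z) :
    y = z :=
  nodePos_injective (by rw [nodePos_eq_of_isBotNode hy, nodePos_eq_of_isBotNode hz])

theorem IsTopNode.not_isBotNode {j : ℕ} {y : Node n} (hy : IsTopNode j y) : ¬ IsBotNode j y := by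
  intro hz
  have h1 := nodePos_eq_of_isTopNode hy
  have h2 := nodePos_eq_of_isBotNode hz
  have h3 := hy.1
  have h4 := hz.1
  omega

theorem shiftNode_inj {j : ℕ} (hj : j ≤ n) {x y : Node n} (hx : ¬ IsCupNode j x)
    (hy : ¬ IsCupNode j y) (h : shiftNode j x = shiftNode j y) : x = y := by
  rw [← (unshift_shift hj hx).1, h, (unshift_shift hj hy).1]

/-- `p` may be the position of an end of a string that is not part of the cup at the gap `j`. -/
def OffCup (n j p : ℕ) : Prop := p ≤ n + 1 ∨ p + j ≠ 2 * n + 1 ∧ p + j ≠ 2 * n + 2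

theorem shiftPos_cases {n j p : ℕ} (hp : OffCup n j p) (hp' : p ≤ 2 * n + 1) :
    (p ≤ n + 1 ∧ shiftPos n j p = p) ∨ (n + 1 < p ∧ p + j ≤ 2 * n ∧ shiftPos n j p = p + 1) ∨
      (n + 1 < p ∧ 2 * n + 3 ≤ p + j ∧ shiftPos n j p + 1 = p) := by
  unfold OffCup at hp
  unfold shiftPos
  split_ifs <;> omega

theorem offCup_nodePos {j : ℕ} {x : Node n} (hx : ¬ IsCupNode j x) : OffCup n j (nodePos x) := by
  rcases x with k | k
  · have h1 : (k : ℕ) + 1 ≠ j ∧ (k : ℕ) ≠ j := by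
      constructor <;> intro h <;> exact hx ⟨k, rfl, by omega⟩
    simp only [nodePos, OffCup]
    omega
  · simp only [nodePos, OffCup]
    omega

theorem nodePos_shiftNode {j : ℕ} (hj : j ≤ n) {x : Node n} (hx : ¬ IsCupNode j x) :
    nodePos (shiftNode j x) = shiftPos n j (nodePos x) := by
  have h := shiftPos_cases (offCup_nodePos hx) (nodePos_le x)
  rcases x with k | k
  · have h1 : (k : ℕ) + 1 ≠ j ∧ (k : ℕ) ≠ j := by
      constructor <;> intro h <;> exact hx ⟨k, rfl, by omega⟩
    simp only [shiftNode, nodePos] at h ⊢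
    split_ifs <;> omega
  · simp only [shiftNode, nodePos] at h ⊢
    omega

theorem not_crosses_shiftPos {n j p q r s : ℕ} (hp : OffCup n j p)
    (hq : OffCup n j q) (hr : OffCup n j r) (hs : OffCup n j s) (hp' : p ≤ 2 * n + 1)
    (hq' : q ≤ 2 * n + 1) (hr' : r ≤ 2 * n + 1) (hs' : s ≤ 2 * n + 1)
    (h : ¬ Crosses p q r s) :
    ¬ Crosses (shiftPos n j p) (shiftPos n j q) (shiftPos n j r) (shiftPos n j s) := by
  have hmono : ∀ x y, OffCup n j x → OffCup n j y → x ≤ 2 * n + 1 → y ≤ 2 * n + 1 → x ≤ y →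
      shiftPos n j x ≤ shiftPos n j y := by
    intro x y hx hy hx' hy' hxy
    have h1 := shiftPos_cases hx hx'
    have h2 := shiftPos_cases hy hy'
    omega
  have e1 := hmono p q hp hq hp' hq'
  have e2 := hmono q p hq hp hq' hp'
  have e3 := hmono r s hr hs hr' hs'
  have e4 := hmono s r hs hr hs' hr'
  have e5 := hmono p r hp hr hp' hr'
  have e6 := hmono r p hr hp hr' hp'
  have e7 := hmono p s hp hs hp' hs'
  have e8 := hmono s p hs hp hs' hp'
  have e9 := hmono q r hq hr hq' hr'
  have e10 := hmono r q hr hq hr' hq'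
  have e11 := hmono q s hq hs hq' hs'
  have e12 := hmono s q hs hq hs' hq'
  unfold Crosses at *
  omega

/-- A string to the top boundary from the position `u` can be moved to the first left node. -/
theorem not_crosses_first {n j u p q : ℕ} (hj : j ≤ n) (hu : OffCup n j u) (hp : OffCup n j p)
    (hq : OffCup n j q) (hu' : u ≤ 2 * n + 1) (hp' : p ≤ 2 * n + 1) (hq' : q ≤ 2 * n + 1)
    (h1 : ¬ Crosses 0 u p q) (hfirst : q = 0 → p ≤ u) (hp0 : 0 < p) :
    ¬ Crosses (2 * n + 1) (shiftPos n j u) (shiftPos n j p) (shiftPos n j q) ∧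
      ¬ Crosses (shiftPos n j p) (shiftPos n j q) (2 * n + 1) (shiftPos n j u) := by
  have e1 := shiftPos_cases hu hu'
  have e2 := shiftPos_cases hp hp'
  have e3 := shiftPos_cases hq hq'
  unfold Crosses at *
  constructor <;> omega

/-- A string to the bottom boundary from the position `v` can be moved to the last left node. -/
theorem not_crosses_last {n j v p q : ℕ} (hj : j ≤ n) (hv : OffCup n j v) (hp : OffCup n j p)
    (hq : OffCup n j q) (hv' : v ≤ 2 * n + 1) (hp' : p ≤ 2 * n + 1) (hq' : q ≤ 2 * n + 1)
    (h1 : ¬ Crosses (n + 1) v p q) (h2 : ¬ Crosses p q (n + 1) v)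
    (hfirst : q = n + 1 → (v ≤ n → p ≤ n ∧ v ≤ p) ∧ (p ≤ n ∨ v ≤ p)) (hp0 : p ≠ n + 1) :
    ¬ Crosses (n + 2) (shiftPos n j v) (shiftPos n j p) (shiftPos n j q) ∧
      ¬ Crosses (shiftPos n j p) (shiftPos n j q) (n + 2) (shiftPos n j v) := by
  have e1 := shiftPos_cases hv hv'
  have e2 := shiftPos_cases hp hp'
  have e3 := shiftPos_cases hq hq'
  unfold Crosses at *
  constructor <;> omega

theorem not_crosses_first_last {n j u v : ℕ} (hj : j ≤ n) (hu : OffCup n j u) (hv : OffCup n j v)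
    (hu' : u ≤ 2 * n + 1) (hv' : v ≤ 2 * n + 1) (hun : u ≠ n + 1) (hvn : v ≠ n + 1)
    (hv0 : 0 < v)
    (h1 : ¬ Crosses 0 u (n + 1) v) :
    ¬ Crosses (2 * n + 1) (shiftPos n j u) (n + 2) (shiftPos n j v) ∧
      ¬ Crosses (n + 2) (shiftPos n j v) (2 * n + 1) (shiftPos n j u) := by
  have e1 := shiftPos_cases hu hu'
  have e2 := shiftPos_cases hv hv'
  unfold Crosses at *
  constructor <;> omega

namespace IsLeftFactor

variable {D : Diagram n X} {j : ℕ} {a b : X} {u v : Node n}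

/-- The left quotient is a diagram, that is, its strings do not cross, since `u` and `v` are the
first nodes with strings to the top and to the bottom boundary. -/
theorem exists_isLeftQuotient (h : IsLeftFactor D j a b u v) :
    ∃ T, IsLeftQuotient D T j u v := by
  classical
  let f : Node n → Node n ⊕ (Bdry × X) := fun y =>
    if IsTopNode j y then Sum.inl (shiftNode j u) else
    if IsBotNode j y then Sum.inl (shiftNode j v) else
    if hu : 0 < j ∧ y = shiftNode j u then Sum.inl (Sum.inl ⟨0, by have := h.le; omega⟩) else
    if hv : j < n ∧ y = shiftNode j v then Sum.inl (Sum.inl ⟨n - 1, by omega⟩) else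
    Sum.map (shiftNode j) id (D.conn (unshiftNode j y))
  have hj := h.le
  have hcu := h.not_isCupNode_u
  have hcv := h.not_isCupNode_v
  have hinj := fun x y => shiftNode_inj hj (x := x) (y := y)
  have ftop : ∀ y, IsTopNode j y → f y = Sum.inl (shiftNode j u) := fun y hy => if_pos hy
  have fbot : ∀ y, IsBotNode j y → f y = Sum.inl (shiftNode j v) := fun y hy => by
    simp only [f]
    rw [if_neg (fun h1 => h1.not_isBotNode hy), if_pos hy]
  have fu : 0 < j → ∃ y, IsTopNode j y ∧ f (shiftNode j u) = Sum.inl y := fun h0 => by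
    obtain ⟨-, h1, h2⟩ := unshift_shift hj (hcu h0)
    refine ⟨_, ⟨h0, ⟨0, by omega⟩, rfl, rfl⟩, ?_⟩
    simp only [f]
    rw [if_neg h1, if_neg h2, dif_pos ⟨h0, trivial⟩]
  have fv : j < n → ∃ y, IsBotNode j y ∧ f (shiftNode j v) = Sum.inl y := fun h0 => by
    obtain ⟨-, h1, h2⟩ := unshift_shift hj (hcv h0)
    refine ⟨_, ⟨h0, ⟨n - 1, by omega⟩, rfl, by simp only; omega⟩, ?_⟩
    simp only [f]
    rw [if_neg h1, if_neg h2, dif_neg, dif_pos ⟨h0, trivial⟩]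
    rintro ⟨h3, h4⟩
    exact h.u_ne_v h3 h0 (hinj _ _ (hcu h3) (hcv h0) h4.symm)
  have fo : ∀ x, ¬ IsCupNode j x → (0 < j → x ≠ u) → (j < n → x ≠ v) →
      f (shiftNode j x) = Sum.map (shiftNode j) id (D.conn x) := fun x hx hxu hxv => by
    obtain ⟨h0, h1, h2⟩ := unshift_shift hj hx
    simp only [f]
    rw [if_neg h1, if_neg h2, dif_neg, dif_neg, h0]
    · rintro ⟨h3, h4⟩
      exact hxv h3 (hinj _ _ hx (hcv h3) h4)
    · rintro ⟨h3, h4⟩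
      exact hxu h3 (hinj _ _ hx (hcu h3) h4)
  have hcase : ∀ y, IsTopNode j y ∨ IsBotNode j y ∨ (0 < j ∧ y = shiftNode j u) ∨
      (j < n ∧ y = shiftNode j v) ∨ ∃ x, ¬ IsCupNode j x ∧ (0 < j → x ≠ u) ∧ (j < n → x ≠ v) ∧
        y = shiftNode j x := by
    intro y
    by_cases h1 : IsTopNode j y
    · exact Or.inl h1
    by_cases h2 : IsBotNode j y
    · exact Or.inr (Or.inl h2)
    obtain ⟨h3, h4⟩ := shift_unshift hj h1 h2
    by_cases h5 : 0 < j ∧ unshiftNode j y = u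
    · exact Or.inr (Or.inr (Or.inl ⟨h5.1, by rw [← h5.2, h3]⟩))
    by_cases h6 : j < n ∧ unshiftNode j y = v
    · exact Or.inr (Or.inr (Or.inr (Or.inl ⟨h6.1, by rw [← h6.2, h3]⟩)))
    · exact Or.inr (Or.inr (Or.inr (Or.inr ⟨_, h4, fun h7 h8 => h5 ⟨h7, h8⟩,
        fun h7 h8 => h6 ⟨h7, h8⟩, h3.symm⟩)))
  -- the strings away from the surgery
  have hother : ∀ x w, ¬ IsCupNode j x → (0 < j → x ≠ u) → (j < n → x ≠ v) →
      D.conn x = Sum.inl w → ¬ IsCupNode j w ∧ (0 < j → w ≠ u) ∧ (j < n → w ≠ v) := by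
    intro x w hx hxu hxv hw
    refine ⟨h.not_isCupNode_of_conn hx hw, ?_, ?_⟩
    · rintro h0 rfl
      have := (h.conn_u h0).symm.trans (D.conn_symm _ _ hw)
      simp at this
    · rintro h0 rfl
      have := (h.conn_v h0).symm.trans (D.conn_symm _ _ hw)
      simp at this
  have hsymm : ∀ y z, f y = Sum.inl z → f z = Sum.inl y := by
    intro y z hyz
    rcases hcase y with hy | hy | ⟨h0, rfl⟩ | ⟨h0, rfl⟩ | ⟨x, hx, hxu, hxv, rfl⟩
    · obtain ⟨y', hy', hf⟩ := fu hy.1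
      rw [ftop y hy, Sum.inl.injEq] at hyz
      rw [← hyz, hf, hy.unique hy']
    · obtain ⟨y', hy', hf⟩ := fv hy.1
      rw [fbot y hy, Sum.inl.injEq] at hyz
      rw [← hyz, hf, hy.unique hy']
    · obtain ⟨y', hy', hf⟩ := fu h0
      rw [hf, Sum.inl.injEq] at hyz
      rw [← hyz, ftop y' hy']
    · obtain ⟨y', hy', hf⟩ := fv h0
      rw [hf, Sum.inl.injEq] at hyz
      rw [← hyz, fbot y' hy']
    · rw [fo x hx hxu hxv] at hyz
      rcases hw : D.conn x with w | c
      · rw [hw, Sum.map_inl, Sum.inl.injEq] at hyz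
        obtain ⟨h1, h2, h3⟩ := hother x w hx hxu hxv hw
        rw [← hyz, fo w h1 h2 h3, D.conn_symm _ _ hw, Sum.map_inl]
      · simp [hw] at hyz
  have hne : ∀ y, f y ≠ Sum.inl y := by
    intro y hyz
    have hut : 0 < j → ¬ IsTopNode j (shiftNode j u) := fun h0 =>
      (unshift_shift hj (hcu h0)).2.1
    have hvb : j < n → ¬ IsBotNode j (shiftNode j v) := fun h0 =>
      (unshift_shift hj (hcv h0)).2.2
    rcases hcase y with hy | hy | ⟨h0, rfl⟩ | ⟨h0, rfl⟩ | ⟨x, hx, hxu, hxv, rfl⟩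
    · rw [ftop y hy, Sum.inl.injEq] at hyz
      exact hut hy.1 (hyz ▸ hy)
    · rw [fbot y hy, Sum.inl.injEq] at hyz
      exact hvb hy.1 (hyz ▸ hy)
    · obtain ⟨y', hy', hf⟩ := fu h0
      rw [hf, Sum.inl.injEq] at hyz
      exact hut h0 (hyz ▸ hy')
    · obtain ⟨y', hy', hf⟩ := fv h0
      rw [hf, Sum.inl.injEq] at hyz
      exact hvb h0 (hyz ▸ hy')
    · rw [fo x hx hxu hxv] at hyz
      rcases hw : D.conn x with w | c
      · rw [hw, Sum.map_inl, Sum.inl.injEq] at hyz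
        obtain ⟨h1, -, -⟩ := hother x w hx hxu hxv hw
        have := hinj _ _ h1 hx hyz
        exact D.conn_ne x (this ▸ hw)
      · simp [hw] at hyz
  -- up to the order of its ends, a string of the new diagram is a shifted old string or one of
  -- the two new strings
  have hchord : ∀ x, ∃ p q, (∀ y z, (Crosses (nodePos x) (endPos (f x)) y z ↔ Crosses p q y z) ∧
        (Crosses y z (nodePos x) (endPos (f x)) ↔ Crosses y z p q)) ∧
      ((p = 2 * n + 1 ∧ q = shiftPos n j (nodePos u) ∧ 0 < j) ∨
        (p = n + 2 ∧ q = shiftPos n j (nodePos v) ∧ j < n) ∨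
        ∃ x, p = shiftPos n j (nodePos x) ∧ q = shiftPos n j (endPos (D.conn x)) ∧
          ¬ IsCupNode j x ∧ OffCup n j (endPos (D.conn x))) := by
    intro y
    rcases hcase y with hy | hy | ⟨h0, rfl⟩ | ⟨h0, rfl⟩ | ⟨x, hx, hxu, hxv, rfl⟩
    · refine ⟨_, _, fun y z => ⟨Iff.rfl, Iff.rfl⟩, Or.inl ⟨nodePos_eq_of_isTopNode hy, ?_, hy.1⟩⟩
      rw [ftop y hy, ← nodePos_shiftNode hj (hcu hy.1)]; rfl
    · refine ⟨_, _, fun y z => ⟨Iff.rfl, Iff.rfl⟩,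
        Or.inr (Or.inl ⟨nodePos_eq_of_isBotNode hy, ?_, hy.1⟩)⟩
      rw [fbot y hy, ← nodePos_shiftNode hj (hcv hy.1)]; rfl
    · obtain ⟨y', hy', hf⟩ := fu h0
      refine ⟨_, _, fun y z => ⟨crosses_comm _ _ _ _, crosses_comm' _ _ _ _⟩,
        Or.inl ⟨?_, nodePos_shiftNode hj (hcu h0), h0⟩⟩
      rw [hf]; exact nodePos_eq_of_isTopNode hy'
    · obtain ⟨y', hy', hf⟩ := fv h0
      refine ⟨_, _, fun y z => ⟨crosses_comm _ _ _ _, crosses_comm' _ _ _ _⟩,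
        Or.inr (Or.inl ⟨?_, nodePos_shiftNode hj (hcv h0), h0⟩)⟩
      rw [hf]; exact nodePos_eq_of_isBotNode hy'
    · have hpos : OffCup n j (endPos (D.conn x)) ∧
          endPos (f (shiftNode j x)) = shiftPos n j (endPos (D.conn x)) := by
        rw [fo x hx hxu hxv]
        rcases hw : D.conn x with w | ⟨_ | _, c⟩
        · have h1 := (hother x w hx hxu hxv hw).1
          exact ⟨offCup_nodePos h1, nodePos_shiftNode hj h1⟩
        · exact ⟨Or.inl (Nat.zero_le _), (if_pos (Nat.zero_le _)).symm⟩
        · exact ⟨Or.inl le_rfl, (if_pos le_rfl).symm⟩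
      exact ⟨_, _, fun y z => ⟨Iff.rfl, Iff.rfl⟩,
        Or.inr (Or.inr ⟨x, nodePos_shiftNode hj hx, hpos.2, hx, hpos.1⟩)⟩
  have hfirst : ∀ x, 0 < j → ¬ IsCupNode j x → OffCup n j (endPos (D.conn x)) →
      ¬ Crosses (2 * n + 1) (shiftPos n j (nodePos u)) (shiftPos n j (nodePos x))
        (shiftPos n j (endPos (D.conn x))) ∧
      ¬ Crosses (shiftPos n j (nodePos x)) (shiftPos n j (endPos (D.conn x)))
        (2 * n + 1) (shiftPos n j (nodePos u)) := by
    intro x h0 hx hxo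
    have h1 := D.planar u x
    rw [h.conn_u h0, crosses_comm] at h1
    refine not_crosses_first hj (offCup_nodePos (hcu h0)) (offCup_nodePos hx) hxo (nodePos_le u)
      (nodePos_le x) (endPos_le _) h1 ?_ (nodePos_pos x)
    intro hq
    rcases hw : D.conn x with w | ⟨_ | _, c⟩ <;> rw [hw] at hq
    · exact absurd hq (nodePos_pos w).ne'
    · exact h.first_u h0 x c hw
    · simp [endPos] at hq
  have hlast : ∀ x, j < n → ¬ IsCupNode j x → OffCup n j (endPos (D.conn x)) →
      ¬ Crosses (n + 2) (shiftPos n j (nodePos v)) (shiftPos n j (nodePos x))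
        (shiftPos n j (endPos (D.conn x))) ∧
      ¬ Crosses (shiftPos n j (nodePos x)) (shiftPos n j (endPos (D.conn x)))
        (n + 2) (shiftPos n j (nodePos v)) := by
    intro x h0 hx hxo
    have h1 := D.planar v x
    have h2 := D.planar x v
    rw [h.conn_v h0, crosses_comm] at h1
    rw [h.conn_v h0, crosses_comm'] at h2
    refine not_crosses_last hj (offCup_nodePos (hcv h0)) (offCup_nodePos hx) hxo (nodePos_le v)
      (nodePos_le x) (endPos_le _) h1 h2 ?_ (nodePos_ne x)
    intro hq
    rcases hw : D.conn x with w | ⟨_ | _, c⟩ <;> rw [hw] at hq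
    · exact absurd hq (nodePos_ne w)
    · simp [endPos] at hq
    · exact h.first_v h0 x c hw
  have hboth : 0 < j → j < n →
      ¬ Crosses (2 * n + 1) (shiftPos n j (nodePos u)) (n + 2) (shiftPos n j (nodePos v)) ∧
      ¬ Crosses (n + 2) (shiftPos n j (nodePos v)) (2 * n + 1) (shiftPos n j (nodePos u)) := by
    intro h0 hn
    have h1 := D.planar u v
    rw [h.conn_u h0, h.conn_v hn, crosses_comm, crosses_comm'] at h1
    exact not_crosses_first_last hj (offCup_nodePos (hcu h0)) (offCup_nodePos (hcv hn))
      (nodePos_le u) (nodePos_le v) (nodePos_ne u) (nodePos_ne v) (nodePos_pos v) h1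
  refine ⟨⟨f, hne, hsymm, ?_⟩, ftop, fbot, fo⟩
  intro x y
  obtain ⟨p, q, hpq, hx⟩ := hchord x
  obtain ⟨r, s, hrs, hy⟩ := hchord y
  rw [(hpq _ _).1, (hrs _ _).2]
  rcases hx with ⟨rfl, rfl, h0⟩ | ⟨rfl, rfl, h0⟩ | ⟨x', rfl, rfl, hx1, hx2⟩ <;>
    rcases hy with ⟨rfl, rfl, h0'⟩ | ⟨rfl, rfl, h0'⟩ | ⟨y', rfl, rfl, hy1, hy2⟩
  · exact not_crosses_self _ _
  · exact (hboth h0 h0').1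
  · exact (hfirst y' h0 hy1 hy2).1
  · exact (hboth h0' h0).2
  · exact not_crosses_self _ _
  · exact (hlast y' h0 hy1 hy2).1
  · exact (hfirst x' h0' hx1 hx2).2
  · exact (hlast x' h0' hx1 hx2).2
  · exact not_crosses_shiftPos (offCup_nodePos hx1) hx2 (offCup_nodePos hy1) hy2 (nodePos_le _)
      (endPos_le _) (nodePos_le _) (endPos_le _) (D.planar x' y')

end IsLeftFactor

theorem exists_bdryLink_of_odd {s : Bdry} {D : Diagram n X} (h : Odd (numBdryLinks s D)) :
    ∃ v a, D.conn v = Sum.inr (s, a) := by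
  by_contra hno
  push Not at hno
  have : numBdryLinks s D = 0 := by
    rw [numBdryLinks, Nat.card_eq_zero]
    exact Or.inl ⟨fun ⟨v, a, ha⟩ => hno v a ha⟩
  rw [this] at h
  simp at h

/-- In a finite type, a satisfiable predicate has a witness that minimizes a given function. -/
theorem exists_first {α : Type*} [Finite α] (p : α → Prop) (g : α → ℕ) (h : ∃ x, p x) :
    ∃ x, p x ∧ ∀ y, p y → g x ≤ g y := by
  obtain ⟨x, hx, hmin⟩ := Set.exists_min_image {x | p x} g (Set.toFinite _) h
  exact ⟨x, hx, hmin⟩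

/-- Every odd diagram has a cup on the left side, and `W(j)` can be factored off there. -/
theorem IsOdd.exists_isLeftFactor {D : Diagram n X} (hD : IsOdd D) :
    ∃ j a b u v, IsLeftFactor D j a b u v := by
  have hone : D ≠ one := by
    rintro rfl
    obtain ⟨v | v, a, h⟩ := exists_bdryLink_of_odd hD.1 <;> simp [one] at h
  obtain ⟨j, A, B, hj, hA, hB, hAB⟩ := exists_cup D hone
  obtain ⟨u, ⟨a, hu⟩, hu'⟩ := exists_first (fun x => ∃ a, D.conn x = Sum.inr (Bdry.top, a))
    (fun x => 2 * n + 1 - nodePos x) (exists_bdryLink_of_odd hD.1)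
  obtain ⟨v, ⟨b, hv⟩, hv'⟩ := exists_first (fun x => ∃ a, D.conn x = Sum.inr (Bdry.bot, a))
    (fun x => if nodePos x ≤ n then nodePos x + 2 * n + 2 else nodePos x)
    (exists_bdryLink_of_odd hD.2)
  have hfu : ∀ x c, D.conn x = Sum.inr (Bdry.top, c) → nodePos x ≤ nodePos u := fun x c hx => by
    have h1 := hu' x ⟨c, hx⟩
    have h2 := nodePos_le x
    have h3 := nodePos_le u
    omega
  have hfv : ∀ x c, D.conn x = Sum.inr (Bdry.bot, c) →
      (nodePos v ≤ n → nodePos x ≤ n ∧ nodePos v ≤ nodePos x) ∧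
        (nodePos x ≤ n ∨ nodePos v ≤ nodePos x) := fun x c hx => by
    have h1 := hv' x ⟨c, hx⟩
    have h2 := nodePos_le x
    have h3 := nodePos_le v
    split_ifs at h1 <;> omega
  rcases hA with ⟨k, hk, rfl⟩ | ⟨rfl, a', rfl⟩ <;> rcases hB with ⟨l, hl, rfl⟩ | ⟨h, b', rfl⟩
  · have hln := l.2
    refine ⟨j, a, b, u, v, hj, ?_, ?_, ?_, fun _ => hu, fun _ => hv, fun _ => hfu, fun _ => hfv⟩
    · intro k' l' hk' hl'
      rw [show k' = k from Fin.ext (by omega), show l' = l from Fin.ext (by omega)]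
      exact hAB.conn_eq
    · omega
    · omega
  · refine ⟨j, a, b', u, v, hj, ?_, ?_, ?_, fun _ => hu, fun h' => ?_, fun _ => hfu,
      fun _ => hfv⟩
    · intro k' l' hk' hl'
      omega
    · omega
    · intro _ k' hk'
      rw [show k' = k from Fin.ext (by omega)]
      exact hAB.conn_eq
    · omega
  · refine ⟨0, a', b, u, v, hj, ?_, ?_, ?_, fun h' => ?_, fun _ => hv, fun _ => hfu,
      fun _ => hfv⟩
    · intro k' l' hk' hl'
      omega
    · intro _ k' hk'
      rw [show k' = l from Fin.ext (by omega)]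
      exact hAB.symm.conn_eq
    · intro h
      have := l.2
      omega
    · omega
  · exact hAB.not_bdry.elim

theorem IsOdd.exists_W_comp (hn : 0 < n) {D : Diagram n X} (hD : IsOdd D) :
    ∃ (a b : X) (j : ℕ) (T : Diagram n X), j ≤ n ∧ IsEven T ∧ ReachesOuter (W a b j) T ∧
      (W a b j).comp T = D := by
  obtain ⟨j, a, b, u, v, h⟩ := hD.exists_isLeftFactor
  obtain ⟨T, hT⟩ := h.exists_isLeftQuotient
  obtain ⟨h1, h2⟩ := h.comp_eq (isShift_W hn a b j h.le) hT
  refine ⟨a, b, j, T, h.le, ?_, h2, h1⟩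
  have hW := isOdd_W hn a b j h.le
  obtain ⟨h3, h4⟩ := hD
  rw [← h1, h2.numBdryLinks_comp, Nat.odd_add] at h3 h4
  exact ⟨h3.1 hW.1, h4.1 hW.2⟩

/-! ### Uniqueness of the second factor -/

/-- If the concatenation of `W(j)` and `T` has no loops and no arcs, the first and the last left
node of `T`, as far as they are glued to boundary strings of `W(j)`, are linked in `T` to nodes whose
strings in the concatenation end on the top and on the bottom boundary, respectively.  All other
strings of `T` can be read off from the concatenation. -/
theorem IsShift.conn_of_clean {G T : Diagram n X} {j : ℕ} {a b : X} (hG : IsShift G j a b)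
    (hj : j ≤ n) (hc : Clean G T) :
    (∀ y, IsTopNode j y → ∃ x, ¬ IsCupNode j x ∧ T.conn y = Sum.inl (shiftNode j x) ∧
      (G.comp T).conn x = Sum.inr (Bdry.top, a)) ∧
    (∀ y, IsBotNode j y → ∃ x, ¬ IsCupNode j x ∧ T.conn y = Sum.inl (shiftNode j x) ∧
      (G.comp T).conn x = Sum.inr (Bdry.bot, b)) ∧
    ∀ x, ¬ IsCupNode j x →
      (∃ y, (IsTopNode j y ∨ IsBotNode j y) ∧ T.conn (shiftNode j x) = Sum.inl y) ∨
      T.conn (shiftNode j x) = Sum.map (shiftNode j) id ((G.comp T).conn x) := by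
  have hs := fun x => hG.joined_shiftNode hj T (x := x)
  -- the boundary end of `G` in which a left node of `T` continues
  have hend : ∀ y, IsTopNode j y ∨ IsBotNode j y → ∃ m : Fin n, y = Sum.inl m ∧
      ∃ c, G.conn (Sum.inr m) = Sum.inr c ∧
        (IsTopNode j y → c = (Bdry.top, a)) ∧ (IsBotNode j y → c = (Bdry.bot, b)) := by
    rintro y (hy | hy)
    · obtain ⟨h0, m, rfl, hm⟩ := id hy
      exact ⟨m, rfl, _, hG.right_top h0 m hm, fun _ => rfl, fun h => absurd h hy.not_isBotNode⟩
    · obtain ⟨h0, m, rfl, hm⟩ := id hy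
      exact ⟨m, rfl, _, hG.right_bot h0 m hm, fun h => absurd hy h.not_isBotNode, fun _ => rfl⟩
  have hlink : ∀ y, IsTopNode j y ∨ IsBotNode j y → ∃ x, ¬ IsCupNode j x ∧
      T.conn y = Sum.inl (shiftNode j x) := by
    intro y hy
    obtain ⟨m, rfl, c, hm, -⟩ := hend y hy
    rcases hw : T.conn (Sum.inl m) with w | d
    · have hnot : ¬ (IsTopNode j w ∨ IsBotNode j w) := by
        intro hw'
        obtain ⟨m', rfl, c', hm', -⟩ := hend w hw'
        refine hc.2 (Sum.inl (Sum.inr m)) (Sum.inl (Sum.inr m')) ⟨?_, ?_, ⟨_, piece_inl_eq.2 hm⟩,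
          ⟨_, piece_inl_eq.2 hm'⟩⟩
        · intro h
          rw [show m = m' by simpa using h] at hw
          exact T.conn_ne _ hw
        · exact (joined_mid G T m).trans ((joined_inr G hw).trans (joined_mid G T m').symm)
      rw [not_or] at hnot
      obtain ⟨h1, h2⟩ := shift_unshift hj hnot.1 hnot.2
      exact ⟨_, h2, by rw [h1]⟩
    · exact absurd ⟨by simp, joined_mid G T m, ⟨_, piece_inl_eq.2 hm⟩, ⟨_, piece_inr_eq.2 hw⟩⟩
        (hc.2 (Sum.inl (Sum.inr m)) (Sum.inr (Sum.inl m)))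
  have hlink' : ∀ y, IsTopNode j y ∨ IsBotNode j y → ∃ x, ¬ IsCupNode j x ∧
      T.conn y = Sum.inl (shiftNode j x) ∧ ∃ c, (G.comp T).conn x = Sum.inr c ∧
        (IsTopNode j y → c = (Bdry.top, a)) ∧ (IsBotNode j y → c = (Bdry.bot, b)) := by
    intro y hy
    obtain ⟨x, hx, hyx⟩ := hlink y hy
    obtain ⟨m, rfl, c, hm, hc'⟩ := hend y hy
    refine ⟨x, hx, hyx, c, ?_, hc'⟩
    exact (hasEnd_iff G T x _).1 ⟨_, (hs x hx).trans ((joined_inr G hyx).symm.trans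
      (joined_mid G T m).symm), piece_inl_eq.2 hm⟩
  refine ⟨?_, ?_, ?_⟩
  · intro y hy
    obtain ⟨x, hx, hyx, c, h1, h2, -⟩ := hlink' y (Or.inl hy)
    exact ⟨x, hx, hyx, h2 hy ▸ h1⟩
  · intro y hy
    obtain ⟨x, hx, hyx, c, h1, -, h2⟩ := hlink' y (Or.inr hy)
    exact ⟨x, hx, hyx, h2 hy ▸ h1⟩
  · intro x hx
    rcases hw : T.conn (shiftNode j x) with w | c
    · by_cases h : IsTopNode j w ∨ IsBotNode j w
      · exact Or.inl ⟨w, h, rfl⟩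
      · rw [not_or] at h
        obtain ⟨h1, h2⟩ := shift_unshift hj h.1 h.2
        have hne : unshiftNode j w ≠ x := by
          rintro rfl
          rw [h1] at hw
          exact T.conn_ne _ hw
        have hj1 := hs _ h2
        rw [h1] at hj1
        rw [(hasEnd_iff G T x (Sum.inl (unshiftNode j w))).1
          ⟨hne, (hs x hx).trans ((joined_inr G hw).trans hj1.symm)⟩]
        exact Or.inr (by rw [Sum.map_inl, h1])
    · rw [(hasEnd_iff G T x (Sum.inr c)).1 ⟨_, hs x hx, piece_inr_eq.2 hw⟩]
      exact Or.inr rfl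

/-- By planarity, the node of `T` that is linked to the first left node is the first one among
those whose strings in the concatenation end on the top boundary. -/
theorem IsShift.first_top {G T : Diagram n X} {j : ℕ} {a b : X} (hG : IsShift G j a b)
    (hj : j ≤ n) (hc : Clean G T) {x y z : Node n} {c : X} (hy : IsTopNode j y)
    (hz : T.conn y = Sum.inl z) (hx : ¬ IsCupNode j x)
    (hxc : (G.comp T).conn x = Sum.inr (Bdry.top, c)) :
    nodePos (shiftNode j x) ≤ nodePos z := by
  obtain ⟨h1, h2, h3⟩ := hG.conn_of_clean hj hc
  rcases h3 x hx with ⟨y', hy', h⟩ | h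
  · rcases hy' with hy' | hy'
    · have h4 := T.conn_symm _ _ h
      rw [← hy.unique hy', hz, Sum.inl.injEq] at h4
      rw [h4]
    · obtain ⟨x', hx', h4, h5⟩ := h2 y' hy'
      have h6 := T.conn_symm _ _ h
      rw [h4, Sum.inl.injEq] at h6
      rw [shiftNode_inj hj hx' hx h6, hxc] at h5
      simp at h5
  · rw [hxc, Sum.map_inr] at h
    have h4 := T.planar (shiftNode j x) y
    have h5 := nodePos_eq_of_isTopNode hy
    have h6 := nodePos_pos z
    have h7 := nodePos_le (shiftNode j x)
    have h8 : shiftNode j x ≠ y := fun h8 => (unshift_shift hj hx).2.1 (h8 ▸ hy)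
    have h9 : nodePos (shiftNode j x) ≠ nodePos y := fun h9 => h8 (nodePos_injective h9)
    rw [h, hz] at h4
    simp only [id, endPos, Crosses] at h4
    omega

/-- The analogue of `IsShift.first_top` for the bottom boundary: the order of the nodes is that from
the last left node up the left side and then down the right side. -/
theorem IsShift.first_bot {G T : Diagram n X} {j : ℕ} {a b : X} (hG : IsShift G j a b)
    (hj : j ≤ n) (hc : Clean G T) {x y z : Node n} {c : X} (hy : IsBotNode j y)
    (hz : T.conn y = Sum.inl z) (hx : ¬ IsCupNode j x)
    (hxc : (G.comp T).conn x = Sum.inr (Bdry.bot, c)) :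
    (nodePos z ≤ n → nodePos (shiftNode j x) ≤ n ∧ nodePos z ≤ nodePos (shiftNode j x)) ∧
      (nodePos (shiftNode j x) ≤ n ∨ nodePos z ≤ nodePos (shiftNode j x)) := by
  obtain ⟨h1, h2, h3⟩ := hG.conn_of_clean hj hc
  have h10 := nodePos_ne (shiftNode j x)
  rcases h3 x hx with ⟨y', hy', h⟩ | h
  · rcases hy' with hy' | hy'
    · obtain ⟨x', hx', h4, h5⟩ := h1 y' hy'
      have h6 := T.conn_symm _ _ h
      rw [h4, Sum.inl.injEq] at h6
      rw [shiftNode_inj hj hx' hx h6, hxc] at h5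
      simp at h5
    · have h4 := T.conn_symm _ _ h
      rw [← hy.unique hy', hz, Sum.inl.injEq] at h4
      rw [h4]
      omega
  · rw [hxc, Sum.map_inr] at h
    have h4 := T.planar (shiftNode j x) y
    have h4' := T.planar y (shiftNode j x)
    have h5 := nodePos_eq_of_isBotNode hy
    have h6 := nodePos_ne z
    have h7 := nodePos_le (shiftNode j x)
    have h8 : shiftNode j x ≠ y := fun h8 => (unshift_shift hj hx).2.2 (h8 ▸ hy)
    have h9 : nodePos (shiftNode j x) ≠ nodePos y := fun h9 => h8 (nodePos_injective h9)
    rw [h, hz] at h4 h4'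
    simp only [id, endPos, Crosses] at h4 h4'
    omega

/-- Cancellation of `W(j)` on the left. -/
theorem IsShift.comp_injective {G T T' : Diagram n X} {j : ℕ} {a b : X} (hG : IsShift G j a b)
    (hj : j ≤ n) (hc : Clean G T) (hc' : Clean G T') (h : G.comp T = G.comp T') : T = T' := by
  obtain ⟨h1, h2, h3⟩ := hG.conn_of_clean hj hc
  obtain ⟨h1', h2', h3'⟩ := hG.conn_of_clean hj hc'
  -- the two diagrams agree at the first and at the last left node
  have hy : ∀ y, IsTopNode j y ∨ IsBotNode j y → T.conn y = T'.conn y := by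
    rintro y (hy | hy)
    · obtain ⟨x, hx, hyx, hxa⟩ := h1 y hy
      obtain ⟨x', hx', hyx', hxa'⟩ := h1' y hy
      have e1 := hG.first_top hj hc hy hyx hx' (h ▸ hxa')
      have e2 := hG.first_top hj hc' hy hyx' hx (h ▸ hxa)
      rw [hyx, hyx', nodePos_injective (le_antisymm e2 e1)]
    · obtain ⟨x, hx, hyx, hxa⟩ := h2 y hy
      obtain ⟨x', hx', hyx', hxa'⟩ := h2' y hy
      have e1 := hG.first_bot hj hc hy hyx hx' (h ▸ hxa')
      have e2 := hG.first_bot hj hc' hy hyx' hx (h ▸ hxa)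
      have e3 : nodePos (shiftNode j x) = nodePos (shiftNode j x') := by omega
      rw [hyx, hyx', nodePos_injective e3]
  ext1
  funext y
  by_cases h4 : IsTopNode j y ∨ IsBotNode j y
  · exact hy y h4
  · rw [not_or] at h4
    obtain ⟨h5, h6⟩ := shift_unshift hj h4.1 h4.2
    have h7 := h3 _ h6
    have h8 := h3' _ h6
    rw [h5] at h7 h8
    rcases h7 with ⟨z, hz, h7⟩ | h7
    · rw [h7]
      exact (T'.conn_symm _ _ ((hy z hz).symm.trans (T.conn_symm _ _ h7))).symm
    rcases h8 with ⟨z, hz, h8⟩ | h8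
    · rw [h8]
      exact T.conn_symm _ _ ((hy z hz).trans (T'.conn_symm _ _ h8))
    · rw [h7, h8, h]

/-! ### Generation of the algebra -/

section Algebra

variable {R : Type*} [CommRing R]

theorem coeff_eq_one_of_clean (P : Params R X) {D E : Diagram n X} (h : Clean D E) :
    coeff P D E = 1 := by
  have h1 : numLoops D E = 0 := by
    rw [numLoops, Nat.card_eq_zero]
    exact Or.inl ⟨fun ⟨s, hs⟩ => h.1 s hs⟩
  simp [coeff, h1, h.2]

theorem LabelAlgebra.of_comp_of_clean (P : Params R X) {D E : Diagram n X} (h : Clean D E) :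
    of P (D.comp E) = of P D * of P E := by
  rw [of_mul_of, coeff_eq_one_of_clean P h, one_smul]

theorem LabelAlgebra.eq_top_of_forall_of_mem (P : Params R X)
    (S : NonUnitalSubalgebra R (LabelAlgebra n P)) (h : ∀ D, of P D ∈ S) : S = ⊤ := by
  rw [eq_top_iff]
  rintro x -
  rw [← (diagramBasis n P).linearCombination_repr x, Finsupp.linearCombination_apply]
  exact S.toSubmodule.sum_mem fun D _ => S.toSubmodule.smul_mem _ (h D)

theorem evenGenerators_subset : evenGenerators n X ⊆ generators n X := by
  rintro D (h | h | h)
  · exact Or.inr (Or.inl h)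
  · exact Or.inr (Or.inr (Or.inl h))
  · exact Or.inr (Or.inr (Or.inr (Or.inl h)))

theorem of_mem_adjoin_generators (P : Params R X) {D : Diagram n X} (hD : D ∈ generators n X) :
    LabelAlgebra.of P D ∈
      NonUnitalAlgebra.adjoin R (LabelAlgebra.of P '' generators n X) :=
  NonUnitalAlgebra.subset_adjoin R (Set.mem_image_of_mem _ hD)

theorem IsCleanProduct.of_mem_adjoin (P : Params R X) {D : Diagram n X}
    (hD : IsCleanProduct (evenGenerators n X) D) :
    LabelAlgebra.of P D ∈
      NonUnitalAlgebra.adjoin R (LabelAlgebra.of P '' generators n X) := by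
  induction hD with
  | one => exact of_mem_adjoin_generators P (Or.inl rfl)
  | of D hD => exact of_mem_adjoin_generators P (evenGenerators_subset hD)
  | comp D E _ _ hc ih1 ih2 =>
    rw [LabelAlgebra.of_comp_of_clean P hc]
    exact mul_mem ih1 ih2

theorem of_W_mem_adjoin (hn : 0 < n) (P : Params R X) (a b : X) (j : ℕ) (hj : j ≤ n) :
    LabelAlgebra.of P (W a b j : Diagram n X) ∈
      NonUnitalAlgebra.adjoin R (LabelAlgebra.of P '' generators n X) := by
  induction j with
  | zero =>
    exact of_mem_adjoin_generators P (Or.inr (Or.inr (Or.inr (Or.inr (Or.inl ⟨a, b, rfl⟩)))))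
  | succ j ih =>
    rw [W]
    split_ifs with h
    · rw [LabelAlgebra.of_comp_of_clean P
        ((isShift_W hn a b j (by omega)).reachesOuter_e h).clean]
      exact mul_mem (of_mem_adjoin_generators P (Or.inr (Or.inl ⟨j, h, rfl⟩))) (ih (by omega))
    · exact of_mem_adjoin_generators P (Or.inr (Or.inr (Or.inr (Or.inr (Or.inr ⟨a, b, rfl⟩)))))

end Algebra

end LabelAlg

theorem theorem3p3 {R X : Type*} [CommRing R] (n : ℕ) (hn : 0 < n)
    (P : LabelAlg.Params R X) :
    NonUnitalAlgebra.adjoin R (LabelAlg.LabelAlgebra.of P '' LabelAlg.generators n X) = ⊤ ∧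
    (∀ T : LabelAlg.Diagram n X, LabelAlg.IsEven T →
      LabelAlg.IsCleanProduct (LabelAlg.evenGenerators n X) T) ∧
    (∀ D : LabelAlg.Diagram n X, LabelAlg.IsOdd D →
      (∃ (a b : X) (j : ℕ) (T : LabelAlg.Diagram n X), j ≤ n ∧ LabelAlg.IsEven T ∧
        LabelAlg.Clean (LabelAlg.W a b j) T ∧ (LabelAlg.W a b j).comp T = D) ∧
      ∀ (a b : X) (j : ℕ) (T T' : LabelAlg.Diagram n X), j ≤ n →
        LabelAlg.Clean (LabelAlg.W a b j) T → (LabelAlg.W a b j).comp T = D →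
        LabelAlg.Clean (LabelAlg.W a b j) T' → (LabelAlg.W a b j).comp T' = D → T = T') := by
  have heven := LabelAlg.isCleanProduct_of_isEven (X := X) hn
  refine ⟨LabelAlg.LabelAlgebra.eq_top_of_forall_of_mem P _ fun D => ?_, heven,
    fun D hD => ⟨?_, ?_⟩⟩
  · rcases LabelAlg.isEven_or_isOdd D with hD | hD
    · exact (heven D hD).of_mem_adjoin P
    · obtain ⟨a, b, j, T, hj, hT, hr, rfl⟩ := hD.exists_W_comp hn
      rw [LabelAlg.LabelAlgebra.of_comp_of_clean P hr.clean]
      exact mul_mem (LabelAlg.of_W_mem_adjoin hn P a b j hj) ((heven T hT).of_mem_adjoin P)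
  · obtain ⟨a, b, j, T, hj, hT, hr, h⟩ := hD.exists_W_comp hn
    exact ⟨a, b, j, T, hj, hT, hr.clean, h⟩
  · intro a b j T T' hj hc h hc' h'
    exact (LabelAlg.isShift_W hn a b j hj).comp_injective hj hc hc' (h.trans h'.symm)
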